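/- Let $n\ge 2$, let $\Omega\subset\mathbb{R}^n$ be open, and let $N$ be a compact $C^\infty$ Riemannian manifold which is smoothly and isometrically embedded in some Euclidean space $\mathbb{R}^p$ (we identify $N$ with its image). For an open set $V\subset\mathbb{R}^n$, $W^{1,2}(V;N)$ is the set of $u\in W^{1,2}(V;\mathbb{R}^p)$ with $u(x)\in N$ for a.e. $x\in V$, and $W^{1,2}_{\mathrm{loc}}(\Omega;N)$ is the set of $u:\Omega\to\mathbb{R}^p$ with $u(x)\in N$ for a.e. $x\in\Omega$ which belong to $W^{1,2}(V;\mathbb{R}^p)$ for every open $V$ whose closure is compact and contained in $\Omega$. Write $|Du|^2=\sum_{i=1}^n\sum_{j=1}^p (D_iu^j)^2$ for the weak derivatives $D_iu^j$. A map $u\in W^{1,2}_{\mathrm{loc}}(\Omega;N)$ is called energy minimizing if for each ball $B_\rho(y)$ with $\overline{B}_\rho(y)\subset\Omega$ $$\int_{B_\rho(y)}|Du|^2\le\int_{B_\rho(y)}|Dw|^2$$ for every $w\in W^{1,2}(B_\rho(y);N)$ with $w=u$ a.e. in a neighbourhood of $\partial B_\rho(y)$. Theorem 3 (upper semicontinuity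 of density). Let $u$ be energy minimizing. Then for every $y\in\Omega$ the limit $$\Theta_u(y)=\lim_{\rho\downarrow 0}\rho^{2-n}\int_{B_\rho(y)}|Du|^2$$ exists in $\mathbb{R}$, and $\Theta_u$ is upper semicontinuous on $\Omega$. That is, for all $y\in\Omega$ and all sequences $y_j\in\Omega$ with $y_j\to y$, $$\limsup_{j\to\infty}\Theta_u(y_j)\le\Theta_u(y).$$ -/

import Mathlib

open MeasureTheory Filter Topology Metric
open scoped ContDiff Manifold

noncomputable section

/-- `g` is an `L²(U)` weak derivative of the scalar function `f` on `U ⊆ ℝⁿ` in the `i`-th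
coordinate direction: `∫_U φ g = - ∫_U f D_i φ` for all `φ ∈ C_c^∞(U)`. -/
def IsWeakPartial {n : ℕ} (U : Set (EuclideanSpace ℝ (Fin n)))
    (f : EuclideanSpace ℝ (Fin n) → ℝ) (i : Fin n) (g : EuclideanSpace ℝ (Fin n) → ℝ) : Prop :=
  MemLp g 2 (volume.restrict U) ∧
    ∀ φ : EuclideanSpace ℝ (Fin n) → ℝ, ContDiff ℝ ∞ φ → HasCompactSupport φ → tsupport φ ⊆ U →
      ∫ x in U, φ x * g x = - ∫ x in U, f x * fderiv ℝ φ x (EuclideanSpace.single i (1 : ℝ))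

/-- `f ∈ W^{1,2}(U)`: `f ∈ L²(U)`, with `L²(U)` weak derivatives in all coordinate directions. -/
def MemW12 {n : ℕ} (U : Set (EuclideanSpace ℝ (Fin n)))
    (f : EuclideanSpace ℝ (Fin n) → ℝ) : Prop :=
  MemLp f 2 (volume.restrict U) ∧ ∀ i : Fin n, ∃ g, IsWeakPartial U f i g

/-- `u ∈ W^{1,2}(U; N)`, for `N ⊆ ℝᵖ`: all components of `u` belong to `W^{1,2}(U)`, and
`u x ∈ N` for almost every `x ∈ U`. -/
def MemW12Map {n p : ℕ} (U : Set (EuclideanSpace ℝ (Fin n)))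
    (N : Set (EuclideanSpace ℝ (Fin p)))
    (u : EuclideanSpace ℝ (Fin n) → EuclideanSpace ℝ (Fin p)) : Prop :=
  (∀ j : Fin p, MemW12 U (fun x => u x j)) ∧ ∀ᵐ x ∂(volume.restrict U), u x ∈ N

/-- `u ∈ W_loc^{1,2}(Ω; N)`: all components of `u` belong to `W^{1,2}(V)` for every open `V`
whose closure is compact and contained in `Ω`, and `u x ∈ N` for almost every `x ∈ Ω`. -/
def MemW12LocMap {n p : ℕ} (Ω : Set (EuclideanSpace ℝ (Fin n)))
    (N : Set (EuclideanSpace ℝ (Fin p)))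
    (u : EuclideanSpace ℝ (Fin n) → EuclideanSpace ℝ (Fin p)) : Prop :=
  (∀ V : Set (EuclideanSpace ℝ (Fin n)), IsOpen V → IsCompact (closure V) → closure V ⊆ Ω →
    ∀ j : Fin p, MemW12 V (fun x => u x j)) ∧ ∀ᵐ x ∂(volume.restrict Ω), u x ∈ N

open scoped Classical in
/-- The weak derivative `D_i f` on `U` (a representative; it is unique almost everywhere in an
open set `U`), and `0` when `f` has no `L²(U)` weak derivative. -/
def weakPartial {n : ℕ} (U : Set (EuclideanSpace ℝ (Fin n)))
    (f : EuclideanSpace ℝ (Fin n) → ℝ) (i : Fin n) : EuclideanSpace ℝ (Fin n) → ℝ :=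
  if h : ∃ g, IsWeakPartial U f i g then h.choose else 0

/-- The energy `∫_U |Du|²`, where `|Du|² = ∑ᵢ ∑ⱼ (D_i u^j)²`. -/
def energy {n p : ℕ} (U : Set (EuclideanSpace ℝ (Fin n)))
    (u : EuclideanSpace ℝ (Fin n) → EuclideanSpace ℝ (Fin p)) : ℝ :=
  ∫ x in U, ∑ i : Fin n, ∑ j : Fin p, (weakPartial U (fun z => u z j) i x) ^ 2

/-- `u` is an energy minimizing map from `Ω ⊆ ℝⁿ` to `N ⊆ ℝᵖ`: it lies in `W_loc^{1,2}(Ω; N)`, and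
on every ball `B` with closure in `Ω` its energy is at most that of every `w ∈ W^{1,2}(B; N)` that
agrees with `u` (almost everywhere) in a neighbourhood of `∂B`. -/
structure IsEnergyMinimizing {n p : ℕ} (Ω : Set (EuclideanSpace ℝ (Fin n)))
    (N : Set (EuclideanSpace ℝ (Fin p)))
    (u : EuclideanSpace ℝ (Fin n) → EuclideanSpace ℝ (Fin p)) : Prop where
  mem : MemW12LocMap Ω N u
  energy_le : ∀ (y : EuclideanSpace ℝ (Fin n)) (ρ : ℝ), 0 < ρ → closedBall y ρ ⊆ Ω →
    ∀ w : EuclideanSpace ℝ (Fin n) → EuclideanSpace ℝ (Fin p), MemW12Map (ball y ρ) N w →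
      (∃ V : Set (EuclideanSpace ℝ (Fin n)), IsOpen V ∧ sphere y ρ ⊆ V ∧
        ∀ᵐ x ∂(volume.restrict (V ∩ ball y ρ)), w x = u x) →
      energy (ball y ρ) u ≤ energy (ball y ρ) w

/-- The scaled energy `ρ^{2-n} ∫_{B_ρ(y)} |Du|²`. -/
def scaledEnergy {n p : ℕ} (u : EuclideanSpace ℝ (Fin n) → EuclideanSpace ℝ (Fin p))
    (y : EuclideanSpace ℝ (Fin n)) (ρ : ℝ) : ℝ :=
  ρ ^ (2 - (n : ℤ)) * energy (ball y ρ) u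

/-- The density `Θ_u(y) = lim_{ρ ↓ 0} ρ^{2-n} ∫_{B_ρ(y)} |Du|²`. -/
def density {n p : ℕ} (u : EuclideanSpace ℝ (Fin n) → EuclideanSpace ℝ (Fin p))
    (y : EuclideanSpace ℝ (Fin n)) : ℝ :=
  limUnder (𝓝[>] (0 : ℝ)) (scaledEnergy u y)

/-- `ι : M → ℝᵖ` is a smooth isometric embedding of the Riemannian manifold `(M, g)`. -/
structure IsIsometricEmbedding {m p : ℕ} {M : Type*} [TopologicalSpace M]
    [ChartedSpace (EuclideanSpace ℝ (Fin m)) M] [IsManifold (𝓡 m) ∞ M]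
    (g : Bundle.ContMDiffRiemannianMetric (𝓡 m) ∞ (EuclideanSpace ℝ (Fin m))
      (fun x : M => TangentSpace (𝓡 m) x))
    (ι : M → EuclideanSpace ℝ (Fin p)) : Prop where
  isSmoothEmbedding : Manifold.IsSmoothEmbedding (𝓡 m) (𝓡 p) ∞ ι
  isometric : ∀ (x : M) (v w : TangentSpace (𝓡 m) x),
    g.inner x v w = inner (𝕜 := ℝ) (E := EuclideanSpace ℝ (Fin p))
      (mfderiv (𝓡 m) (𝓡 p) ι x v) (mfderiv (𝓡 m) (𝓡 p) ι x w)

end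

/-! The engine is the monotonicity formula: ρ ↦ ρ^{2-n} ∫_{B_ρ(y)} |Du|² is nondecreasing.
Precomposing `u` with a diffeomorphism that is the identity near the boundary of a ball keeps the
values in `N` and the boundary behaviour, so it gives an admissible competitor, and the geometry of
`N` plays no further role. Varying one coordinate at a time by x ↦ x + sη(x)e_k and letting s → 0
yields the stationarity identity `IsEnergyMinimizing.first_variation`.

Summed over k for the radial field h(|z-y|²)(z-y) with h decreasing, the identity contains the
squared radial derivative of `u` with a favourable sign. Dropping that term
(`IsEnergyMinimizing.integral_radial_nonpos`) leaves an inequality which, for h(t) = H(t/ρ²), says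
exactly that the derivative in ρ of ρ^{2-n} ∫ H(|z-y|²/ρ²)|Du|² is nonnegative. Letting H tend to
the indicator of [0,1) gives `IsEnergyMinimizing.monotoneOn_scaledEnergy`.

The density is then an infimum of scaled energies. For r slightly below ρ and x close to y, Θ(x) ≤
r^{2-n} ∫_{B_r(x)} |Du|² ≤ r^{2-n} ∫_{B_ρ(y)} |Du|², and the last quantity is close to the scaled
energy at (y, ρ); this gives upper semicontinuity. -/

noncomputable section

/-! ### Weak partial derivatives -/

section WeakPartial

variable {n : ℕ} {U V : Set (EuclideanSpace ℝ (Fin n))} {f g g₁ g₂ : EuclideanSpace ℝ (Fin n) → ℝ}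
  {i : Fin n}

theorem setIntegral_eq_integral_of_tsupport_subset {E : Type*} [TopologicalSpace E]
    [MeasurableSpace E] {μ : Measure E} {U : Set E} {φ f : E → ℝ} (h : tsupport φ ⊆ U) :
    ∫ x in U, φ x * f x ∂μ = ∫ x, φ x * f x ∂μ :=
  setIntegral_eq_integral_of_forall_compl_eq_zero fun x hx => by
    rw [image_eq_zero_of_notMem_tsupport fun h' => hx (h h'), zero_mul]

/-- For a test function supported in `V`, the integrals over `V` and over `U` both equal the
integral over the whole space. -/
theorem IsWeakPartial.mono (hVU : V ⊆ U) (h : IsWeakPartial U f i g) : IsWeakPartial V f i g := by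
  refine ⟨h.1.mono_measure (Measure.restrict_mono hVU le_rfl), fun φ hφ hc hs => ?_⟩
  have key := h.2 φ hφ hc (hs.trans hVU)
  have hs' := (tsupport_fderiv_apply_subset ℝ (EuclideanSpace.single i (1 : ℝ))).trans hs
  simp_rw [mul_comm (f _)] at key ⊢
  rwa [setIntegral_eq_integral_of_tsupport_subset (hs.trans hVU),
    setIntegral_eq_integral_of_tsupport_subset (hs'.trans hVU),
    ← setIntegral_eq_integral_of_tsupport_subset hs,
    ← setIntegral_eq_integral_of_tsupport_subset hs'] at key

theorem locallyIntegrable_of_memLp_two (h : MemLp g 2 (volume.restrict U)) :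
    LocallyIntegrable g (volume.restrict U) := by
  refine (locallyIntegrable_iff).2 fun K hK => ?_
  have : IsFiniteMeasure ((volume.restrict U).restrict K) :=
    ⟨by
      rw [Measure.restrict_apply_univ]
      exact (Measure.restrict_apply_le _ _).trans_lt hK.measure_lt_top⟩
  exact (h.restrict K).integrable (by norm_num)

theorem IsWeakPartial.locallyIntegrable (h : IsWeakPartial U f i g) :
    LocallyIntegrable g (volume.restrict U) :=
  locallyIntegrable_of_memLp_two h.1

theorem integrable_mul_of_hasCompactSupport {μ : Measure (EuclideanSpace ℝ (Fin n))}
    {φ : EuclideanSpace ℝ (Fin n) → ℝ} (hg : LocallyIntegrable g μ) (hφ : Continuous φ)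
    (hc : HasCompactSupport φ) : Integrable (fun x => φ x * g x) μ := by
  simpa using hg.integrable_smul_left_of_hasCompactSupport hφ hc

theorem IsWeakPartial.ae_eq (hU : IsOpen U) (h₁ : IsWeakPartial U f i g₁)
    (h₂ : IsWeakPartial U f i g₂) : g₁ =ᵐ[volume.restrict U] g₂ := by
  have hloc := h₁.locallyIntegrable.sub h₂.locallyIntegrable
  have key := hU.ae_eq_zero_of_integral_contDiff_smul_eq_zero (μ := volume.restrict U)
    (f := g₁ - g₂) (hloc.locallyIntegrableOn U) fun φ hφ hc hs => by
      have e : ∀ x, φ x • (g₁ - g₂) x = φ x * g₁ x - φ x * g₂ x := fun x => by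
        simp [mul_sub]
      simp_rw [e]
      rw [integral_sub
        (integrable_mul_of_hasCompactSupport h₁.locallyIntegrable hφ.continuous hc)
        (integrable_mul_of_hasCompactSupport h₂.locallyIntegrable hφ.continuous hc),
        h₁.2 φ hφ hc hs, h₂.2 φ hφ hc hs, sub_self]
  filter_upwards [key, ae_restrict_mem hU.measurableSet] with x hx hxU
  exact sub_eq_zero.1 (hx hxU)

theorem isWeakPartial_weakPartial (h : ∃ g, IsWeakPartial U f i g) :
    IsWeakPartial U f i (weakPartial U f i) := by
  rw [weakPartial, dif_pos h]
  exact h.choose_spec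

theorem IsWeakPartial.weakPartial_ae_eq (hU : IsOpen U) (h : IsWeakPartial U f i g) :
    weakPartial U f i =ᵐ[volume.restrict U] g :=
  (isWeakPartial_weakPartial ⟨g, h⟩).ae_eq hU h

theorem energy_eq_of_isWeakPartial {p : ℕ} (hU : IsOpen U)
    {u : EuclideanSpace ℝ (Fin n) → EuclideanSpace ℝ (Fin p)}
    {D : Fin n → Fin p → EuclideanSpace ℝ (Fin n) → ℝ}
    (hD : ∀ i j, IsWeakPartial U (fun x => u x j) i (D i j)) :
    energy U u = ∫ x in U, ∑ i, ∑ j, D i j x ^ 2 := by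
  refine integral_congr_ae ?_
  have h : ∀ᵐ x ∂(volume.restrict U), ∀ i j, weakPartial U (fun z => u z j) i x = D i j x :=
    ae_all_iff.2 fun i => ae_all_iff.2 fun j => (hD i j).weakPartial_ae_eq hU
  filter_upwards [h] with x hx
  simp only [hx]

end WeakPartial

/-! ### Domain variations in a coordinate direction -/

section Shear

variable {n : ℕ}

/-- `Φ` is the homeomorphism `x ↦ x + η x • e_k`, where `η` is smooth with compact support and
`‖Dη‖ ≤ 1/2`. -/
structure IsShear (η : EuclideanSpace ℝ (Fin n) → ℝ) (k : Fin n)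
    (Φ : EuclideanSpace ℝ (Fin n) ≃ₜ EuclideanSpace ℝ (Fin n)) : Prop where
  contDiff : ContDiff ℝ ∞ η
  compact : HasCompactSupport η
  small : ∀ x, ‖fderiv ℝ η x‖ ≤ 1 / 2
  apply : ∀ x, Φ x = x + η x • EuclideanSpace.single k (1 : ℝ)

/-- The perturbation η e_k of the identity is Lipschitz with constant 1/2 < 1, so the quantitative
inverse function theorem gives a global homeomorphism. -/
theorem exists_isShear {η : EuclideanSpace ℝ (Fin n) → ℝ} (hη : ContDiff ℝ ∞ η)
    (hc : HasCompactSupport η) (hs : ∀ x, ‖fderiv ℝ η x‖ ≤ 1 / 2) (k : Fin n) :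
    ∃ Φ, IsShear η k Φ := by
  have hlip : LipschitzWith (1 / 2) η :=
    lipschitzWith_of_nnnorm_fderiv_le (hη.differentiable (by simp)) fun x => by
      rw [← NNReal.coe_le_coe]
      simpa using hs x
  have happ : ApproximatesLinearOn (fun x => x + η x • EuclideanSpace.single k (1 : ℝ))
      ((ContinuousLinearEquiv.refl ℝ (EuclideanSpace ℝ (Fin n)) :
        EuclideanSpace ℝ (Fin n) →L[ℝ] EuclideanSpace ℝ (Fin n))) Set.univ (1 / 2) := by
    intro x _ y _
    have e : x + η x • EuclideanSpace.single k (1 : ℝ) - (y + η y • EuclideanSpace.single k (1 : ℝ))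
        - (x - y) = (η x - η y) • EuclideanSpace.single k (1 : ℝ) := by
      rw [sub_smul]; abel
    have h1 := hlip.norm_sub_le x y
    simpa [e, norm_smul] using h1
  have : Nonempty (Fin n) := ⟨k⟩
  refine ⟨happ.toHomeomorph _ (Or.inr ?_), hη, hc, hs, fun x => rfl⟩
  have : ‖(((ContinuousLinearEquiv.refl ℝ (EuclideanSpace ℝ (Fin n))).symm :
      EuclideanSpace ℝ (Fin n) ≃L[ℝ] EuclideanSpace ℝ (Fin n)) :
        EuclideanSpace ℝ (Fin n) →L[ℝ] EuclideanSpace ℝ (Fin n))‖₊ = 1 := by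
    rw [← NNReal.coe_inj]
    simp
  rw [this, inv_one, ← NNReal.coe_lt_coe]
  norm_num

namespace IsShear

variable {η : EuclideanSpace ℝ (Fin n) → ℝ} {k : Fin n}
  {Φ : EuclideanSpace ℝ (Fin n) ≃ₜ EuclideanSpace ℝ (Fin n)}

/-- The differential of a shear. -/
def deriv (η : EuclideanSpace ℝ (Fin n) → ℝ) (k : Fin n) (x : EuclideanSpace ℝ (Fin n)) :
    EuclideanSpace ℝ (Fin n) →L[ℝ] EuclideanSpace ℝ (Fin n) :=
  ContinuousLinearMap.id ℝ _ + (fderiv ℝ η x).smulRight (EuclideanSpace.single k (1 : ℝ))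

/-- The Jacobian determinant `1 + D_k η` of a shear. -/
def jac (η : EuclideanSpace ℝ (Fin n) → ℝ) (k : Fin n) (x : EuclideanSpace ℝ (Fin n)) : ℝ :=
  1 + fderiv ℝ η x (EuclideanSpace.single k (1 : ℝ))

theorem det_deriv (η : EuclideanSpace ℝ (Fin n) → ℝ) (k : Fin n) (x : EuclideanSpace ℝ (Fin n)) :
    (deriv η k x).det = jac η k x := by
  rw [ContinuousLinearMap.det, jac]
  -- The differential is a rank-one perturbation of the identity, so its determinant is 1 plus the
  -- functional evaluated at the vector.
  convert LinearMap.transvection.det (fderiv ℝ η x : EuclideanSpace ℝ (Fin n) →ₗ[ℝ] ℝ)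
    (EuclideanSpace.single k (1 : ℝ)) using 2
  · rfl
  · rfl

theorem hasFDerivAt (h : IsShear η k Φ) (x : EuclideanSpace ℝ (Fin n)) :
    HasFDerivAt Φ (deriv η k x) x := by
  have : (Φ : EuclideanSpace ℝ (Fin n) → EuclideanSpace ℝ (Fin n)) =
      fun x => x + η x • EuclideanSpace.single k (1 : ℝ) := funext h.apply
  rw [this]
  exact (hasFDerivAt_id x).add
    (((h.contDiff.differentiable (by simp)) x).hasFDerivAt.smul_const _)

theorem abs_fderiv_single_le (h : IsShear η k Φ) (x : EuclideanSpace ℝ (Fin n)) (i : Fin n) :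
    |fderiv ℝ η x (EuclideanSpace.single i (1 : ℝ))| ≤ 1 / 2 := by
  have := (fderiv ℝ η x).le_opNorm (EuclideanSpace.single i (1 : ℝ))
  simp only [PiLp.norm_single, norm_one, mul_one, Real.norm_eq_abs] at this
  exact this.trans (h.small x)

theorem half_le_jac (h : IsShear η k Φ) (x : EuclideanSpace ℝ (Fin n)) : 1 / 2 ≤ jac η k x := by
  have := (abs_le.1 (h.abs_fderiv_single_le x k)).1
  rw [jac]; linarith

theorem jac_pos (h : IsShear η k Φ) (x : EuclideanSpace ℝ (Fin n)) : 0 < jac η k x :=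
  lt_of_lt_of_le (by norm_num) (h.half_le_jac x)

theorem contDiff_toFun (h : IsShear η k Φ) : ContDiff ℝ ∞ Φ := by
  have : (Φ : EuclideanSpace ℝ (Fin n) → EuclideanSpace ℝ (Fin n)) =
      fun x => x + η x • EuclideanSpace.single k (1 : ℝ) := funext h.apply
  rw [this]
  exact contDiff_id.add (h.contDiff.smul contDiff_const)

theorem contDiff_symm (h : IsShear η k Φ) : ContDiff ℝ ∞ Φ.symm := by
  refine Φ.contDiff_symm (f₀' := fun a => (deriv η k a).toContinuousLinearEquivOfDetNeZero ?_)
    (fun a => ?_) h.contDiff_toFun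
  · rw [det_deriv]; exact (h.jac_pos a).ne'
  · rw [ContinuousLinearMap.coe_toContinuousLinearEquivOfDetNeZero]; exact h.hasFDerivAt a

theorem contDiff_fderiv_apply (h : IsShear η k Φ) (i : Fin n) :
    ContDiff ℝ ∞ fun x => fderiv ℝ η x (EuclideanSpace.single i (1 : ℝ)) :=
  (h.contDiff.fderiv_right (by simp)).clm_apply contDiff_const

theorem contDiff_jac (h : IsShear η k Φ) : ContDiff ℝ ∞ (jac η k) :=
  contDiff_const.add (h.contDiff_fderiv_apply k)

/-- Every point outside `U` is fixed, so by injectivity no point of `U` can leave it. -/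
theorem preimage_eq (h : IsShear η k Φ) {U : Set (EuclideanSpace ℝ (Fin n))} (hU : tsupport η ⊆ U) :
    Φ ⁻¹' U = U := by
  have hfix : ∀ x, x ∉ U → Φ x = x := fun x hx => by
    rw [h.apply, image_eq_zero_of_notMem_tsupport fun h' => hx (hU h'), zero_smul, add_zero]
  have hsub : Φ ⁻¹' U ⊆ U := fun x hx => by
    by_contra hxU
    exact hxU (hfix x hxU ▸ hx)
  refine hsub.antisymm fun x hx => ?_
  by_contra hxU
  have h1 : Φ (Φ x) = Φ x := hfix _ hxU
  exact hxU (show Φ x ∈ U from (Φ.injective h1).symm ▸ hx)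

theorem image_eq (h : IsShear η k Φ) {U : Set (EuclideanSpace ℝ (Fin n))} (hU : tsupport η ⊆ U) :
    Φ '' U = U := by
  conv_lhs => rw [← h.preimage_eq hU]
  exact Set.image_preimage_eq U Φ.surjective

/-- Change of variables for a shear. -/
theorem setIntegral_eq (h : IsShear η k Φ) {U : Set (EuclideanSpace ℝ (Fin n))}
    (hU : tsupport η ⊆ U) (hm : MeasurableSet U) (f : EuclideanSpace ℝ (Fin n) → ℝ) :
    ∫ x in U, f x = ∫ z in U, (jac η k (Φ.symm z))⁻¹ * f (Φ.symm z) := by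
  have key := integral_image_eq_integral_abs_det_fderiv_smul volume hm
    (fun x _ => (h.hasFDerivAt x).hasFDerivWithinAt) Φ.injective.injOn
    (fun z => (jac η k (Φ.symm z))⁻¹ * f (Φ.symm z))
  rw [h.image_eq hU] at key
  rw [key]
  refine integral_congr_ae (ae_of_all _ fun x => ?_)
  simp only [det_deriv, abs_of_pos (h.jac_pos x), Homeomorph.symm_apply_apply, smul_eq_mul]
  rw [mul_inv_cancel_left₀ (h.jac_pos x).ne']

/-- The Jacobian is at least 1/2, so a shear compresses volume by a factor of at most 2. This
transfers L² membership and almost-everywhere statements to compositions with the shear. -/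
theorem map_restrict_le (h : IsShear η k Φ) {U : Set (EuclideanSpace ℝ (Fin n))}
    (hU : tsupport η ⊆ U) (hm : MeasurableSet U) :
    Measure.map Φ (volume.restrict U) ≤ (2 : ENNReal) • volume.restrict U := by
  have key := map_withDensity_abs_det_fderiv_eq_addHaar volume hm.nullMeasurableSet
    (fun x _ => (h.hasFDerivAt x).hasFDerivWithinAt) (Φ.injective.injOn (s := U))
  rw [h.image_eq hU] at key
  conv_rhs => rw [← key, ← Measure.map_smul]
  refine Measure.map_mono ?_ Φ.continuous.measurable
  refine Measure.le_iff.2 fun s hs => ?_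
  rw [Measure.smul_apply, withDensity_apply _ hs, smul_eq_mul, ← lintegral_const_mul' _ _ (by simp),
    ← setLIntegral_one]
  refine lintegral_mono fun x => ?_
  rw [det_deriv, abs_of_pos (h.jac_pos x)]
  have : (2 : ENNReal) = ENNReal.ofReal 2 := by simp
  rw [this, ← ENNReal.ofReal_mul (by norm_num), ← ENNReal.ofReal_one]
  refine ENNReal.ofReal_le_ofReal ?_
  linarith [h.half_le_jac x]

theorem memLp_comp (h : IsShear η k Φ) {U : Set (EuclideanSpace ℝ (Fin n))}
    (hU : tsupport η ⊆ U) (hm : MeasurableSet U) {f : EuclideanSpace ℝ (Fin n) → ℝ}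
    (hf : MemLp f 2 (volume.restrict U)) :
    MemLp (fun x => f (Φ x)) 2 (volume.restrict U) := by
  have h2 : MemLp f 2 ((2 : ENNReal) • volume.restrict U) := hf.smul_measure (by simp)
  exact (h2.mono_measure (h.map_restrict_le hU hm)).comp_of_map Φ.continuous.measurable.aemeasurable

theorem ae_comp (h : IsShear η k Φ) {U : Set (EuclideanSpace ℝ (Fin n))}
    (hU : tsupport η ⊆ U) (hm : MeasurableSet U) {q : EuclideanSpace ℝ (Fin n) → Prop}
    (hq : ∀ᵐ x ∂(volume.restrict U), q x) : ∀ᵐ x ∂(volume.restrict U), q (Φ x) := by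
  have h1 : ∀ᵐ x ∂(Measure.map Φ (volume.restrict U)), q x :=
    ((Measure.absolutelyContinuous_of_le (h.map_restrict_le hU hm)).trans
      Measure.smul_absolutelyContinuous).ae_le hq
  exact ae_of_ae_map Φ.continuous.measurable.aemeasurable h1

theorem fderiv_comp_single (h : IsShear η k Φ) {v : EuclideanSpace ℝ (Fin n) → ℝ}
    (hv : Differentiable ℝ v) (i : Fin n) (x : EuclideanSpace ℝ (Fin n)) :
    fderiv ℝ (fun x => v (Φ x)) x (EuclideanSpace.single i (1 : ℝ)) =
      fderiv ℝ v (Φ x) (EuclideanSpace.single i (1 : ℝ)) +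
        fderiv ℝ η x (EuclideanSpace.single i (1 : ℝ)) *
          fderiv ℝ v (Φ x) (EuclideanSpace.single k (1 : ℝ)) := by
  have h1 : HasFDerivAt (fun x => v (Φ x)) _ x := (hv (Φ x)).hasFDerivAt.comp x (h.hasFDerivAt x)
  rw [h1.fderiv]
  simp [deriv]

end IsShear

end Shear

/-! ### The chain rule under shears -/

section ChainRule

variable {n : ℕ}

theorem integral_mul_fderiv_eq_neg_of_hasCompactSupport {f g : EuclideanSpace ℝ (Fin n) → ℝ}
    (hf : ContDiff ℝ ∞ f) (hg : ContDiff ℝ ∞ g) (hc : HasCompactSupport g)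
    (v : EuclideanSpace ℝ (Fin n)) :
    ∫ x, f x * fderiv ℝ g x v = -∫ x, fderiv ℝ f x v * g x := by
  have hf' : Continuous fun x => fderiv ℝ f x v :=
    ((hf.fderiv_right (m := ∞) (by simp)).clm_apply contDiff_const).continuous
  have hg' : Continuous fun x => fderiv ℝ g x v :=
    ((hg.fderiv_right (m := ∞) (by simp)).clm_apply contDiff_const).continuous
  have hc' : HasCompactSupport fun x => fderiv ℝ g x v :=
    hc.mono' ((subset_tsupport _).trans (tsupport_fderiv_apply_subset ℝ v))
  exact integral_mul_fderiv_eq_neg_fderiv_mul_of_integrable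
    ((hf'.mul hg.continuous).integrable_of_hasCompactSupport hc.mul_left)
    ((hf.continuous.mul hg').integrable_of_hasCompactSupport hc'.mul_left)
    ((hf.continuous.mul hg.continuous).integrable_of_hasCompactSupport hc.mul_left)
    (fun x _ => hf.differentiable (by simp) x) (fun x _ => hg.differentiable (by simp) x)

namespace IsShear

variable {η : EuclideanSpace ℝ (Fin n) → ℝ} {k : Fin n}
  {Φ : EuclideanSpace ℝ (Fin n) ≃ₜ EuclideanSpace ℝ (Fin n)}

/-- The pushforward `φ ∘ Φ⁻¹ / det DΦ` of a test function. -/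
def push (η : EuclideanSpace ℝ (Fin n) → ℝ) (k : Fin n)
    (Φ : EuclideanSpace ℝ (Fin n) ≃ₜ EuclideanSpace ℝ (Fin n))
    (φ : EuclideanSpace ℝ (Fin n) → ℝ) (z : EuclideanSpace ℝ (Fin n)) : ℝ :=
  (jac η k (Φ.symm z))⁻¹ * φ (Φ.symm z)

theorem contDiff_push (h : IsShear η k Φ) {φ : EuclideanSpace ℝ (Fin n) → ℝ}
    (hφ : ContDiff ℝ ∞ φ) : ContDiff ℝ ∞ (push η k Φ φ) :=
  ((h.contDiff_jac.comp h.contDiff_symm).inv fun _ => (h.jac_pos _).ne').mul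
    (hφ.comp h.contDiff_symm)

theorem hasCompactSupport_push {φ : EuclideanSpace ℝ (Fin n) → ℝ} (hφ : HasCompactSupport φ) :
    HasCompactSupport (push η k Φ φ) :=
  (hφ.comp_homeomorph Φ.symm).mul_left

theorem tsupport_push_subset (h : IsShear η k Φ) {U : Set (EuclideanSpace ℝ (Fin n))}
    (hU : tsupport η ⊆ U) {φ : EuclideanSpace ℝ (Fin n) → ℝ} (hφ : tsupport φ ⊆ U) :
    tsupport (push η k Φ φ) ⊆ U := by
  refine (tsupport_mul_subset_right (f := fun z => (jac η k (Φ.symm z))⁻¹)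
    (g := φ ∘ Φ.symm)).trans ?_
  rw [tsupport_comp_eq_preimage, ← Φ.image_eq_preimage_symm]
  exact (Set.image_mono hφ).trans (h.image_eq hU).subset

theorem setIntegral_push (h : IsShear η k Φ) {U : Set (EuclideanSpace ℝ (Fin n))}
    (hU : tsupport η ⊆ U) (hm : MeasurableSet U) (φ f : EuclideanSpace ℝ (Fin n) → ℝ) :
    ∫ x in U, φ x * f (Φ x) = ∫ z in U, push η k Φ φ z * f z := by
  rw [h.setIntegral_eq hU hm]
  simp only [push, Homeomorph.apply_symm_apply, mul_assoc]

theorem integral_push (h : IsShear η k Φ) (φ f : EuclideanSpace ℝ (Fin n) → ℝ) :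
    ∫ x, φ x * f (Φ x) = ∫ z, push η k Φ φ z * f z := by
  simpa using h.setIntegral_push (Set.subset_univ _) MeasurableSet.univ φ f

/-- The divergence identity for pushforwards of test functions (Piola's identity). -/
theorem fderiv_push_add (h : IsShear η k Φ) {φ : EuclideanSpace ℝ (Fin n) → ℝ}
    (hφ : ContDiff ℝ ∞ φ) (hc : HasCompactSupport φ) (i : Fin n) (z : EuclideanSpace ℝ (Fin n)) :
    fderiv ℝ (push η k Φ φ) z (EuclideanSpace.single i (1 : ℝ)) +
      fderiv ℝ (push η k Φ fun x => φ x * fderiv ℝ η x (EuclideanSpace.single i (1 : ℝ))) z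
        (EuclideanSpace.single k (1 : ℝ)) =
      push η k Φ (fun x => fderiv ℝ φ x (EuclideanSpace.single i (1 : ℝ))) z := by
  set χ : EuclideanSpace ℝ (Fin n) → ℝ :=
    fun x => φ x * fderiv ℝ η x (EuclideanSpace.single i (1 : ℝ)) with hχ
  have hχs : ContDiff ℝ ∞ χ := hφ.mul (h.contDiff_fderiv_apply i)
  have hχc : HasCompactSupport χ := hc.mul_right
  have hdφ : ContDiff ℝ ∞ fun x => fderiv ℝ φ x (EuclideanSpace.single i (1 : ℝ)) :=
    (hφ.fderiv_right (by simp)).clm_apply contDiff_const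
  have c1 : Continuous fun z =>
      fderiv ℝ (push η k Φ φ) z (EuclideanSpace.single i (1 : ℝ)) :=
    (((h.contDiff_push hφ).fderiv_right (m := ∞) (by simp)).clm_apply contDiff_const).continuous
  have c2 : Continuous fun z =>
      fderiv ℝ (push η k Φ χ) z (EuclideanSpace.single k (1 : ℝ)) :=
    (((h.contDiff_push hχs).fderiv_right (m := ∞) (by simp)).clm_apply contDiff_const).continuous
  have c3 := (h.contDiff_push hdφ).continuous
  have hcont := (c1.add c2).sub c3
  have key : ∀ᵐ z, (fderiv ℝ (push η k Φ φ) z (EuclideanSpace.single i (1 : ℝ)) +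
      fderiv ℝ (push η k Φ χ) z (EuclideanSpace.single k (1 : ℝ)) -
      push η k Φ (fun x => fderiv ℝ φ x (EuclideanSpace.single i (1 : ℝ))) z) = 0 := by
    -- The identity is checked weakly: paired with `v`, it becomes integration by parts of `v ∘ Φ`
    -- against `φ` together with the smooth chain rule. No second derivatives of `Φ.symm` need to be
    -- computed, and continuity upgrades the result to every point.
    refine ae_eq_zero_of_integral_contDiff_smul_eq_zero hcont.locallyIntegrable
      fun v hv hvc => ?_
    have hvΦ : ContDiff ℝ ∞ fun x => v (Φ x) := hv.comp h.contDiff_toFun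
    have int : ∀ {f : EuclideanSpace ℝ (Fin n) → ℝ}, Continuous f →
        Integrable fun x => v x * f x := fun hf =>
      (hv.continuous.mul hf).integrable_of_hasCompactSupport hvc.mul_right
    have dv : ∀ l : Fin n, Continuous fun x => fderiv ℝ v x (EuclideanSpace.single l (1 : ℝ)) :=
      fun l => ((hv.fderiv_right (m := ∞) (by simp)).clm_apply contDiff_const).continuous
    have int' : ∀ {f : EuclideanSpace ℝ (Fin n) → ℝ} (l : Fin n), Continuous f →
        HasCompactSupport f →
        Integrable fun x => f x * fderiv ℝ v (Φ x) (EuclideanSpace.single l (1 : ℝ)) :=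
      fun l hf hfc => (hf.mul ((dv l).comp Φ.continuous)).integrable_of_hasCompactSupport
        hfc.mul_right
    simp only [smul_eq_mul, mul_sub, mul_add]
    have int12 : Integrable fun x =>
        v x * fderiv ℝ (push η k Φ φ) x (EuclideanSpace.single i (1 : ℝ)) +
          v x * fderiv ℝ (push η k Φ χ) x (EuclideanSpace.single k (1 : ℝ)) :=
      (int c1).add (int c2)
    rw [integral_sub int12 (int c3), integral_add (int c1) (int c2),
      integral_mul_fderiv_eq_neg_of_hasCompactSupport hv (h.contDiff_push hφ)
        (hasCompactSupport_push hc),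
      integral_mul_fderiv_eq_neg_of_hasCompactSupport hv (h.contDiff_push hχs)
        (hasCompactSupport_push hχc)]
    have e3 : ∫ x, v x * push η k Φ (fun x => fderiv ℝ φ x (EuclideanSpace.single i (1 : ℝ))) x =
        -((∫ x, fderiv ℝ v x (EuclideanSpace.single i (1 : ℝ)) * push η k Φ φ x) +
          ∫ x, fderiv ℝ v x (EuclideanSpace.single k (1 : ℝ)) * push η k Φ χ x) := by
      simp_rw [mul_comm _ (push η k Φ _ _)]
      rw [← h.integral_push, ← h.integral_push, ← h.integral_push]
      simp_rw [mul_comm _ (v _)]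
      rw [integral_mul_fderiv_eq_neg_of_hasCompactSupport hvΦ hφ hc,
        ← integral_add (int' i hφ.continuous hc) (int' k hχs.continuous hχc)]
      congr 2
      ext x
      rw [h.fderiv_comp_single (hv.differentiable (by simp)), hχ]
      ring
    rw [e3]
    ring
  have hz := congrFun ((Continuous.ae_eq_iff_eq volume hcont continuous_const).1 key) z
  exact sub_eq_zero.1 hz

/-- The chain rule for weak derivatives under a shear. -/
theorem isWeakPartial_comp (h : IsShear η k Φ) {U : Set (EuclideanSpace ℝ (Fin n))}
    (hU : tsupport η ⊆ U) (hUo : IsOpen U) {f : EuclideanSpace ℝ (Fin n) → ℝ}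
    {g : Fin n → EuclideanSpace ℝ (Fin n) → ℝ} (hf : MemLp f 2 (volume.restrict U))
    (hg : ∀ i, IsWeakPartial U f i (g i)) (i : Fin n) :
    IsWeakPartial U (fun x => f (Φ x)) i
      (fun x => g i (Φ x) + fderiv ℝ η x (EuclideanSpace.single i (1 : ℝ)) * g k (Φ x)) := by
  have hm := hUo.measurableSet
  refine ⟨(h.memLp_comp hU hm (hg i).1).add ?_, fun φ hφ hc hs => ?_⟩
  · have h1 := h.memLp_comp hU hm (hg k).1
    refine MemLp.of_le h1 ((h.contDiff_fderiv_apply i).continuous.aestronglyMeasurable.mul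
      h1.aestronglyMeasurable) (ae_of_all _ fun x => ?_)
    rw [norm_mul]
    have := h.abs_fderiv_single_le x i
    exact mul_le_of_le_one_left (norm_nonneg _) (by rw [Real.norm_eq_abs]; linarith)
  · set χ : EuclideanSpace ℝ (Fin n) → ℝ :=
      fun x => φ x * fderiv ℝ η x (EuclideanSpace.single i (1 : ℝ)) with hχ
    have hχs : ContDiff ℝ ∞ χ := hφ.mul (h.contDiff_fderiv_apply i)
    have hχc : HasCompactSupport χ := hc.mul_right
    have hχU : tsupport χ ⊆ U := tsupport_mul_subset_left.trans hs
    have hfloc : LocallyIntegrable f (volume.restrict U) :=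
      locallyIntegrable_of_memLp_two hf
    have cont : ∀ {ψ : EuclideanSpace ℝ (Fin n) → ℝ} (l : Fin n), ContDiff ℝ ∞ ψ →
        HasCompactSupport ψ → Integrable (fun x =>
          f x * fderiv ℝ ψ x (EuclideanSpace.single l (1 : ℝ))) (volume.restrict U) :=
      fun l hψ hψc => by
        simp_rw [mul_comm (f _)]
        exact integrable_mul_of_hasCompactSupport hfloc
          ((hψ.fderiv_right (m := ∞) (by simp)).clm_apply contDiff_const).continuous
          (hψc.mono' ((subset_tsupport _).trans (tsupport_fderiv_apply_subset ℝ _)))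
    have hL : ∫ x in U, φ x * (g i (Φ x) +
        fderiv ℝ η x (EuclideanSpace.single i (1 : ℝ)) * g k (Φ x)) =
        (∫ z in U, push η k Φ φ z * g i z) + ∫ z in U, push η k Φ χ z * g k z := by
      rw [h.setIntegral_eq hU hm, ← integral_add
        (integrable_mul_of_hasCompactSupport (hg i).locallyIntegrable
          (h.contDiff_push hφ).continuous (hasCompactSupport_push hc))
        (integrable_mul_of_hasCompactSupport (hg k).locallyIntegrable
          (h.contDiff_push hχs).continuous (hasCompactSupport_push hχc))]
      congr 1
      ext z
      simp only [push, Homeomorph.apply_symm_apply, hχ]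
      ring
    have hR : ∫ x in U, f (Φ x) * fderiv ℝ φ x (EuclideanSpace.single i (1 : ℝ)) =
        (∫ z in U, f z * fderiv ℝ (push η k Φ φ) z (EuclideanSpace.single i (1 : ℝ))) +
          ∫ z in U, f z * fderiv ℝ (push η k Φ χ) z (EuclideanSpace.single k (1 : ℝ)) := by
      rw [← integral_add (cont i (h.contDiff_push hφ) (hasCompactSupport_push hc))
        (cont k (h.contDiff_push hχs) (hasCompactSupport_push hχc))]
      simp_rw [mul_comm (f (Φ _))]
      rw [h.setIntegral_push hU hm]
      congr 1
      ext z
      rw [← h.fderiv_push_add hφ hc]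
      ring
    -- Both sides now live on the image side, where the pushed-forward functions are legitimate test
    -- functions for the weak derivatives of `f`.
    rw [hL, hR, (hg i).2 _ (h.contDiff_push hφ) (hasCompactSupport_push hc)
      (h.tsupport_push_subset hU hs), (hg k).2 _ (h.contDiff_push hχs)
      (hasCompactSupport_push hχc) (h.tsupport_push_subset hU hχU)]
    ring

end IsShear

end ChainRule

/-! ### The first variation of the energy -/

section FirstVariation

variable {n p : ℕ} {Ω : Set (EuclideanSpace ℝ (Fin n))} {N : Set (EuclideanSpace ℝ (Fin p))}
  {u : EuclideanSpace ℝ (Fin n) → EuclideanSpace ℝ (Fin p)} {y : EuclideanSpace ℝ (Fin n)} {R : ℝ}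

theorem IsEnergyMinimizing.isWeakPartial (hu : IsEnergyMinimizing Ω N u)
    (hR : closedBall y R ⊆ Ω) (i : Fin n) (j : Fin p) :
    IsWeakPartial (ball y R) (fun x => u x j) i (weakPartial (ball y R) (fun x => u x j) i) :=
  isWeakPartial_weakPartial ((hu.mem.1 (ball y R) isOpen_ball
    ((isCompact_closedBall y R).of_isClosed_subset isClosed_closure closure_ball_subset_closedBall)
    (closure_ball_subset_closedBall.trans hR) j).2 i)

theorem IsEnergyMinimizing.memLp (hu : IsEnergyMinimizing Ω N u)
    (hR : closedBall y R ⊆ Ω) (j : Fin p) : MemLp (fun x => u x j) 2 (volume.restrict (ball y R)) :=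
  (hu.mem.1 (ball y R) isOpen_ball
    ((isCompact_closedBall y R).of_isClosed_subset isClosed_closure closure_ball_subset_closedBall)
    (closure_ball_subset_closedBall.trans hR) j).1

/-- Minimality against the competitor `u ∘ Φ`. After the change of variables the rough functions `D
i j` stand at the fixed point `z`, and only smooth coefficients are evaluated at `Φ.symm z`. -/
theorem IsEnergyMinimizing.integral_le_of_isShear (hu : IsEnergyMinimizing Ω N u) (h0 : 0 < R)
    (hR : closedBall y R ⊆ Ω) {D : Fin n → Fin p → EuclideanSpace ℝ (Fin n) → ℝ}
    (hD : ∀ i j, IsWeakPartial (ball y R) (fun x => u x j) i (D i j))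
    {η : EuclideanSpace ℝ (Fin n) → ℝ} {k : Fin n}
    {Φ : EuclideanSpace ℝ (Fin n) ≃ₜ EuclideanSpace ℝ (Fin n)} (h : IsShear η k Φ)
    (hs : tsupport η ⊆ ball y R) :
    ∫ z in ball y R, ∑ i, ∑ j, D i j z ^ 2 ≤
      ∫ z in ball y R, (IsShear.jac η k (Φ.symm z))⁻¹ * ∑ i, ∑ j, (D i j z +
        fderiv ℝ η (Φ.symm z) (EuclideanSpace.single i (1 : ℝ)) * D k j z) ^ 2 := by
  have hchain : ∀ i j, IsWeakPartial (ball y R) (fun x => u (Φ x) j) i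
      (fun x => D i j (Φ x) + fderiv ℝ η x (EuclideanSpace.single i (1 : ℝ)) * D k j (Φ x)) :=
    fun i j => h.isWeakPartial_comp hs isOpen_ball (hu.memLp hR j) (fun i => hD i j) i
  have hN : ∀ᵐ x ∂(volume.restrict (ball y R)), u x ∈ N :=
    ae_restrict_of_ae_restrict_of_subset (ball_subset_closedBall.trans hR) hu.mem.2
  have key := hu.energy_le y R h0 hR (fun x => u (Φ x))
    ⟨fun j => ⟨h.memLp_comp hs measurableSet_ball (hu.memLp hR j), fun i => ⟨_, hchain i j⟩⟩,
      h.ae_comp hs measurableSet_ball hN⟩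
    -- The support of `η` is a closed subset of the open ball, so its complement is a neighbourhood
    -- of the sphere, and there `Φ` is the identity.
    ⟨(tsupport η)ᶜ, (isClosed_tsupport η).isOpen_compl, fun x hx hx' => ?_, ?_⟩
  · rw [energy_eq_of_isWeakPartial isOpen_ball hD, energy_eq_of_isWeakPartial isOpen_ball hchain,
      h.setIntegral_eq hs measurableSet_ball (fun x => ∑ i, ∑ j, (D i j (Φ x) +
        fderiv ℝ η x (EuclideanSpace.single i (1 : ℝ)) * D k j (Φ x)) ^ 2)] at key
    simpa only [Homeomorph.apply_symm_apply] using key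
  · have := hs hx'
    rw [mem_ball] at this
    rw [mem_sphere] at hx
    exact this.ne hx
  · filter_upwards [ae_restrict_mem
      ((isClosed_tsupport η).isOpen_compl.inter isOpen_ball).measurableSet] with x hx
    rw [h.apply, image_eq_zero_of_notMem_tsupport hx.1, zero_smul, add_zero]

/-- The integral is the limit of the difference quotients of the energy along the shears by `s m *
η`, each nonnegative by minimality. -/
theorem IsEnergyMinimizing.first_variation_nonneg (hu : IsEnergyMinimizing Ω N u) (h0 : 0 < R)
    (hR : closedBall y R ⊆ Ω) {D : Fin n → Fin p → EuclideanSpace ℝ (Fin n) → ℝ}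
    (hD : ∀ i j, IsWeakPartial (ball y R) (fun x => u x j) i (D i j))
    {η : EuclideanSpace ℝ (Fin n) → ℝ} (hη : ContDiff ℝ ∞ η) (hc : HasCompactSupport η)
    (hs : tsupport η ⊆ ball y R) (k : Fin n) :
    0 ≤ ∫ z in ball y R, ∑ i, ∑ j,
      (2 * fderiv ℝ η z (EuclideanSpace.single i (1 : ℝ)) * (D i j z * D k j z) -
        fderiv ℝ η z (EuclideanSpace.single k (1 : ℝ)) * D i j z ^ 2) := by
  set a : Fin n → EuclideanSpace ℝ (Fin n) → ℝ :=
    fun i z => fderiv ℝ η z (EuclideanSpace.single i (1 : ℝ)) with ha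
  have hdη : Continuous (fderiv ℝ η) := hη.continuous_fderiv (by simp)
  have hacont : ∀ i, Continuous (a i) := fun i => hdη.clm_apply continuous_const
  obtain ⟨C, hC⟩ := (hc.fderiv (𝕜 := ℝ)).exists_bound_of_continuous hdη
  obtain ⟨C', hC'⟩ := hc.exists_bound_of_continuous hη.continuous
  have hC0 : 0 ≤ C := (norm_nonneg _).trans (hC 0)
  have haC : ∀ i z, |a i z| ≤ C := fun i z => by
    have := (fderiv ℝ η z).le_opNorm (EuclideanSpace.single i (1 : ℝ))
    simp only [PiLp.norm_single, norm_one, mul_one, Real.norm_eq_abs] at this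
    exact this.trans (hC z)
  -- The first factor makes the differential of `s m * η` at most 1/2 in norm, as a shear requires;
  -- the second sends `s m` to 0.
  set s : ℕ → ℝ := fun m => (1 / (2 * (C + 1))) * (1 / ((m : ℝ) + 1)) with hsdef
  have hs0 : ∀ m, 0 < s m := fun m => by positivity
  have hsC : ∀ m, s m ≤ 1 / (2 * (C + 1)) := fun m => by
    refine mul_le_of_le_one_right (by positivity) ?_
    rw [div_le_one (by positivity)]
    linarith [(Nat.cast_nonneg m : (0 : ℝ) ≤ m)]
  have hs1 : ∀ m, s m ≤ 1 := fun m => (hsC m).trans (by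
    rw [div_le_one (by positivity)]; linarith)
  have hslim : Tendsto s atTop (𝓝 0) := by
    have := (tendsto_one_div_add_atTop_nhds_zero_nat (𝕜 := ℝ)).const_mul (1 / (2 * (C + 1)))
    rwa [mul_zero] at this
  have hfd : ∀ m x, fderiv ℝ (fun x => s m * η x) x = s m • fderiv ℝ η x := fun m x =>
    fderiv_const_mul (hη.differentiable (by simp) x) _
  have hex : ∀ m, ∃ Φ, IsShear (fun x => s m * η x) k Φ := fun m =>
    exists_isShear (contDiff_const.mul hη) hc.mul_left (fun x => by
      rw [hfd, norm_smul, Real.norm_eq_abs, abs_of_pos (hs0 m)]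
      calc s m * ‖fderiv ℝ η x‖ ≤ 1 / (2 * (C + 1)) * (C + 1) :=
            mul_le_mul (hsC m) ((hC x).trans (by linarith)) (norm_nonneg _) (by positivity)
        _ = 1 / 2 := by field_simp) k
  choose Φ hΦ using hex
  have hsupp : ∀ m, tsupport (fun x => s m * η x) ⊆ ball y R := fun m =>
    tsupport_mul_subset_right.trans hs
  set J : ℕ → EuclideanSpace ℝ (Fin n) → ℝ :=
    fun m z => (1 + s m * a k ((Φ m).symm z))⁻¹ with hJ
  have hjac : ∀ m z, IsShear.jac (fun x => s m * η x) k z = 1 + s m * a k z := fun m z => by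
    rw [IsShear.jac, hfd]; rfl
  have hJhalf : ∀ m z, 1 / 2 ≤ 1 + s m * a k ((Φ m).symm z) := fun m z => by
    rw [← hjac]; exact (hΦ m).half_le_jac _
  have hJpos : ∀ m z, 0 < 1 + s m * a k ((Φ m).symm z) := fun m z =>
    lt_of_lt_of_le (by norm_num) (hJhalf m z)
  have hJ2 : ∀ m z, |J m z| ≤ 2 := fun m z => by
    rw [hJ, abs_of_pos (inv_pos.2 (hJpos m z))]
    exact inv_le_of_inv_le₀ (by norm_num) (by linarith [hJhalf m z])
  have hJcont : ∀ m, Continuous (J m) := fun m =>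
    (continuous_const.add (continuous_const.mul ((hacont k).comp (Φ m).symm.continuous))).inv₀
      fun z => (hJpos m z).ne'
  have hDm : ∀ i j, AEStronglyMeasurable (D i j) (volume.restrict (ball y R)) :=
    fun i j => (hD i j).1.aestronglyMeasurable
  -- Pointwise difference quotient: `J` times the perturbed square, minus `D i j z ^ 2`, divided by
  -- `s m`.
  set q : ℕ → Fin n → Fin p → EuclideanSpace ℝ (Fin n) → ℝ := fun m i j z =>
    J m z * (2 * a i ((Φ m).symm z) * (D i j z * D k j z) +
      s m * a i ((Φ m).symm z) ^ 2 * D k j z ^ 2 - a k ((Φ m).symm z) * D i j z ^ 2) with hq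
  set b : Fin n → Fin p → EuclideanSpace ℝ (Fin n) → ℝ := fun i j z =>
    2 * (2 * C * ‖D i j z * D k j z‖ + C ^ 2 * D k j z ^ 2 + C * D i j z ^ 2) with hb
  have hbint : ∀ i j, Integrable (b i j) (volume.restrict (ball y R)) := fun i j =>
    (((((hD i j).1.integrable_mul (hD k j).1).norm.const_mul (2 * C)).add
      ((hD k j).1.integrable_sq.const_mul (C ^ 2))).add
        ((hD i j).1.integrable_sq.const_mul C)).const_mul 2
  have hqb : ∀ m i j z, ‖q m i j z‖ ≤ b i j z := fun m i j z => by
    rw [hq, hb, norm_mul]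
    refine mul_le_mul (hJ2 m z) ?_ (norm_nonneg _) (by norm_num)
    refine (norm_sub_le _ _).trans (add_le_add ((norm_add_le _ _).trans (add_le_add ?_ ?_)) ?_)
    · rw [norm_mul, norm_mul, Real.norm_eq_abs, Real.norm_eq_abs (a _ _), abs_two]
      have := haC i ((Φ m).symm z)
      gcongr
    · rw [norm_mul, norm_mul, Real.norm_eq_abs, Real.norm_eq_abs, Real.norm_eq_abs,
        abs_of_pos (hs0 m), abs_of_nonneg (sq_nonneg (D k j z)), abs_pow]
      have h1 : |a i ((Φ m).symm z)| ^ 2 ≤ C ^ 2 := pow_le_pow_left₀ (abs_nonneg _) (haC _ _) 2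
      exact mul_le_mul_of_nonneg_right
        ((mul_le_of_le_one_left (by positivity) (hs1 m)).trans h1) (sq_nonneg _)
    · rw [norm_mul, Real.norm_eq_abs, Real.norm_eq_abs, abs_of_nonneg (sq_nonneg (D i j z))]
      exact mul_le_mul_of_nonneg_right (haC _ _) (sq_nonneg _)
  have hqm : ∀ m i j, AEStronglyMeasurable (q m i j) (volume.restrict (ball y R)) := fun m i j => by
    have c : ∀ l, AEStronglyMeasurable (fun z => a l ((Φ m).symm z)) (volume.restrict (ball y R)) :=
      fun l => ((hacont l).comp (Φ m).symm.continuous).aestronglyMeasurable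
    exact (hJcont m).aestronglyMeasurable.mul (((((c i).const_mul 2).mul
      ((hDm i j).mul (hDm k j))).add ((((c i).pow 2).const_mul (s m)).mul ((hDm k j).pow 2))).sub
        ((c k).mul ((hDm i j).pow 2)))
  have hqint : ∀ m i j, Integrable (q m i j) (volume.restrict (ball y R)) := fun m i j =>
    (hbint i j).mono' (hqm m i j) (ae_of_all _ fun z => hqb m i j z)
  have hqsum : ∀ m, Integrable (fun z => ∑ i, ∑ j, q m i j z) (volume.restrict (ball y R)) :=
    fun m => integrable_finsetSum _ fun i _ => integrable_finsetSum _ fun j _ => hqint m i j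
  have hPint : Integrable (fun z => ∑ i, ∑ j, D i j z ^ 2) (volume.restrict (ball y R)) :=
    integrable_finsetSum _ fun i _ => integrable_finsetSum _ fun j _ => (hD i j).1.integrable_sq
  have hqnonneg : ∀ m, 0 ≤ ∫ z in ball y R, ∑ i, ∑ j, q m i j z := fun m => by
    have h1 := hu.integral_le_of_isShear h0 hR hD (hΦ m) (hsupp m)
    have h2 : ∀ z, (IsShear.jac (fun x => s m * η x) k ((Φ m).symm z))⁻¹ * ∑ i, ∑ j, (D i j z +
        fderiv ℝ (fun x => s m * η x) ((Φ m).symm z) (EuclideanSpace.single i (1 : ℝ)) *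
          D k j z) ^ 2 = (∑ i, ∑ j, D i j z ^ 2) + s m * ∑ i, ∑ j, q m i j z := fun z => by
      rw [hjac, Finset.mul_sum, Finset.mul_sum, ← Finset.sum_add_distrib]
      refine Finset.sum_congr rfl fun i _ => ?_
      rw [Finset.mul_sum, Finset.mul_sum, ← Finset.sum_add_distrib]
      refine Finset.sum_congr rfl fun j _ => ?_
      have e : fderiv ℝ (fun x => s m * η x) ((Φ m).symm z) (EuclideanSpace.single i (1 : ℝ)) =
          s m * a i ((Φ m).symm z) := by rw [hfd]; rfl
      rw [e, hq, hJ]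
      have := (hJpos m z).ne'
      field_simp
      ring
    simp_rw [h2] at h1
    rw [integral_add hPint ((hqsum m).const_mul _), integral_const_mul] at h1
    have h3 : 0 ≤ s m * ∫ z in ball y R, ∑ i, ∑ j, q m i j z := by linarith
    exact nonneg_of_mul_nonneg_right h3 (hs0 m)
  have hlim : Tendsto (fun m => ∫ z in ball y R, ∑ i, ∑ j, q m i j z) atTop
      (𝓝 (∫ z in ball y R, ∑ i, ∑ j, (2 * a i z * (D i j z * D k j z) - a k z * D i j z ^ 2))) := by
    -- Only the continuous functions `a` are evaluated at the moving point `(Φ m).symm z`, so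
    -- pointwise convergence needs no regularity of `D`.
    refine tendsto_integral_of_dominated_convergence (fun z => ∑ i, ∑ j, b i j z)
      (fun m => (hqsum m).aestronglyMeasurable)
      (integrable_finsetSum _ fun i _ => integrable_finsetSum _ fun j _ => hbint i j)
      (fun m => ae_of_all _ fun z => norm_sum_le_of_le _ fun i _ => norm_sum_le_of_le _ fun j _ =>
        hqb m i j z) (ae_of_all _ fun z => ?_)
    have hsymm : Tendsto (fun m => (Φ m).symm z) atTop (𝓝 z) := by
      rw [tendsto_iff_norm_sub_tendsto_zero]
      refine squeeze_zero (fun _ => norm_nonneg _) (fun m => ?_)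
        (by simpa using hslim.mul_const C')
      have h1 : z = (Φ m).symm z + (s m * η ((Φ m).symm z)) • EuclideanSpace.single k (1 : ℝ) := by
        rw [← (hΦ m).apply, Homeomorph.apply_symm_apply]
      have h2 : (Φ m).symm z - z = -((s m * η ((Φ m).symm z)) • EuclideanSpace.single k (1 : ℝ)) := by
        rw [sub_eq_iff_eq_add, neg_add_eq_sub, eq_sub_iff_add_eq]
        exact h1.symm
      rw [h2, norm_neg, norm_smul, norm_mul, PiLp.norm_single, norm_one, mul_one,
        Real.norm_eq_abs, abs_of_pos (hs0 m)]
      exact mul_le_mul_of_nonneg_left (hC' _) (hs0 m).le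
    have hal : ∀ i, Tendsto (fun m => a i ((Φ m).symm z)) atTop (𝓝 (a i z)) := fun i =>
      ((hacont i).tendsto z).comp hsymm
    have hJl : Tendsto (fun m => J m z) atTop (𝓝 1) := by
      have := ((hslim.mul (hal k)).const_add 1).inv₀ (by simp)
      simpa using this
    refine tendsto_finsetSum _ fun i _ => tendsto_finsetSum _ fun j _ => ?_
    have := hJl.mul (((((hal i).const_mul 2).mul_const (D i j z * D k j z)).add
      ((hslim.mul ((hal i).pow 2)).mul_const (D k j z ^ 2))).sub
        ((hal k).mul_const (D i j z ^ 2)))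
    simpa using this
  exact ge_of_tendsto' hlim hqnonneg

/-- The expression is linear in `η`, so the one-sided inequality for `η` and for `-η` gives
equality. -/
theorem IsEnergyMinimizing.first_variation (hu : IsEnergyMinimizing Ω N u) (h0 : 0 < R)
    (hR : closedBall y R ⊆ Ω) {D : Fin n → Fin p → EuclideanSpace ℝ (Fin n) → ℝ}
    (hD : ∀ i j, IsWeakPartial (ball y R) (fun x => u x j) i (D i j))
    {η : EuclideanSpace ℝ (Fin n) → ℝ} (hη : ContDiff ℝ ∞ η) (hc : HasCompactSupport η)
    (hs : tsupport η ⊆ ball y R) (k : Fin n) :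
    ∫ z in ball y R, ∑ i, ∑ j,
      (2 * fderiv ℝ η z (EuclideanSpace.single i (1 : ℝ)) * (D i j z * D k j z) -
        fderiv ℝ η z (EuclideanSpace.single k (1 : ℝ)) * D i j z ^ 2) = 0 := by
  refine le_antisymm ?_ (hu.first_variation_nonneg h0 hR hD hη hc hs k)
  have hts : tsupport (fun x => -η x) = tsupport η := by
    simp [tsupport, Function.support]
  have key := hu.first_variation_nonneg h0 hR hD (η := fun x => -η x) hη.neg
    (by rw [HasCompactSupport, hts]; exact hc) (hts ▸ hs) k
  rw [← neg_nonneg, ← integral_neg]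
  refine key.trans_eq (integral_congr_ae (ae_of_all _ fun z => ?_))
  have : fderiv ℝ (fun x => -η x) z = -fderiv ℝ η z := fderiv_fun_neg
  simp only [this, ← Finset.sum_neg_distrib, neg_apply]
  exact Finset.sum_congr rfl fun i _ => Finset.sum_congr rfl fun j _ => by ring

end FirstVariation

/-! ### Radial variations -/

section Radial

variable {n p : ℕ} {Ω : Set (EuclideanSpace ℝ (Fin n))} {N : Set (EuclideanSpace ℝ (Fin p))}
  {u : EuclideanSpace ℝ (Fin n) → EuclideanSpace ℝ (Fin p)} {y : EuclideanSpace ℝ (Fin n)} {R : ℝ}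

theorem fderiv_radial_mul_coord {h : ℝ → ℝ} (hh : Differentiable ℝ h)
    (y z : EuclideanSpace ℝ (Fin n)) (k i : Fin n) :
    fderiv ℝ (fun z => h (‖z - y‖ ^ 2) * (z k - y k)) z (EuclideanSpace.single i (1 : ℝ)) =
      2 * deriv h (‖z - y‖ ^ 2) * ((z i - y i) * (z k - y k)) +
        h (‖z - y‖ ^ 2) * if i = k then 1 else 0 := by
  have h1 : HasFDerivAt (fun z : EuclideanSpace ℝ (Fin n) => ‖z - y‖ ^ 2) _ z :=
    ((hasFDerivAt_id z).sub_const y).norm_sq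
  have h2 := ((hh (‖z - y‖ ^ 2)).hasDerivAt.comp_hasFDerivAt z h1)
  have h3 : HasFDerivAt (fun z : EuclideanSpace ℝ (Fin n) => z k - y k)
      (EuclideanSpace.proj k : EuclideanSpace ℝ (Fin n) →L[ℝ] ℝ) z :=
    (EuclideanSpace.proj k : EuclideanSpace ℝ (Fin n) →L[ℝ] ℝ).hasFDerivAt.sub_const (y k)
  have h4 : HasFDerivAt (fun z => h (‖z - y‖ ^ 2) * (z k - y k)) _ z := h2.mul h3
  rw [h4.fderiv]
  simp [EuclideanSpace.inner_single_right, eq_comm]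
  ring

/-- Pointwise algebra for the first variation along h(|x|²)x, with `s` and `t` standing for h and
h'. The three sums in the proof are the radial derivative term, the trace term and the divergence
term. The trivial `if k = k` matches the shape given by `fderiv_radial_mul_coord` at `i = k`. -/
theorem sum_radial_variation (d : Fin n → Fin p → ℝ) (x : Fin n → ℝ) (s t : ℝ) :
    ∑ k, ∑ i, ∑ j, (2 * (2 * t * (x i * x k) + s * if i = k then 1 else 0) * (d i j * d k j) -
        (2 * t * (x k * x k) + s * if k = k then 1 else 0) * d i j ^ 2) =
      4 * t * ∑ j, (∑ i, x i * d i j) ^ 2 -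
        (((n : ℝ) - 2) * s + 2 * t * ∑ i, x i ^ 2) * ∑ i, ∑ j, d i j ^ 2 := by
  have e1 : ∑ k, ∑ i, ∑ j, 4 * t * ((x i * d i j) * (x k * d k j)) =
      4 * t * ∑ j, (∑ i, x i * d i j) ^ 2 := by
    simp_rw [sq, Finset.sum_mul_sum, Finset.mul_sum]
    rw [Finset.sum_comm_cycle]
    exact Finset.sum_congr rfl fun j _ => Finset.sum_congr rfl fun k _ =>
      Finset.sum_congr rfl fun i _ => by ring
  have e2 : ∑ k, ∑ i, ∑ j, 2 * s * ((if i = k then 1 else 0) * (d i j * d k j)) =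
      2 * s * ∑ i, ∑ j, d i j ^ 2 := by
    rw [Finset.mul_sum]
    refine Finset.sum_congr rfl fun k _ => ?_
    rw [Finset.sum_eq_single k (fun i _ hik => by simp [hik]) (by simp), Finset.mul_sum]
    simp [sq]
  have e3 : ∑ k, ∑ i, ∑ j, (2 * t * x k ^ 2 + s) * d i j ^ 2 =
      (2 * t * ∑ i, x i ^ 2 + n * s) * ∑ i, ∑ j, d i j ^ 2 := by
    simp_rw [← Finset.mul_sum]
    rw [← Finset.sum_mul, Finset.sum_add_distrib, ← Finset.mul_sum]
    simp
  calc _ = (∑ k, ∑ i, ∑ j, 4 * t * ((x i * d i j) * (x k * d k j))) +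
      (∑ k, ∑ i, ∑ j, 2 * s * ((if i = k then 1 else 0) * (d i j * d k j))) -
      ∑ k, ∑ i, ∑ j, (2 * t * x k ^ 2 + s) * d i j ^ 2 := by
        simp only [← Finset.sum_add_distrib, ← Finset.sum_sub_distrib]
        refine Finset.sum_congr rfl fun k _ => Finset.sum_congr rfl fun i _ =>
          Finset.sum_congr rfl fun j _ => ?_
        simp only [if_true]
        ring
    _ = _ := by rw [e1, e2, e3]; ring

theorem integrable_continuous_mul {μ : Measure (EuclideanSpace ℝ (Fin n))}
    {c f : EuclideanSpace ℝ (Fin n) → ℝ} (hc : Continuous c) (hs : HasCompactSupport c)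
    (hf : Integrable f μ) : Integrable (fun z => c z * f z) μ := by
  obtain ⟨C, hC⟩ := hs.exists_bound_of_continuous hc
  exact hf.bdd_mul hc.aestronglyMeasurable (ae_of_all _ hC)

theorem deriv_eq_zero_of_forall_le {h : ℝ → ℝ} {c : ℝ} (hd : Differentiable ℝ h)
    (hz : ∀ t, c ≤ t → h t = 0) {t : ℝ} (ht : c ≤ t) : deriv h t = 0 := by
  -- A one-sided derivative covers the endpoint `t = c`, where `h` is known to vanish only to the
  -- right.
  have h1 : HasDerivWithinAt h 0 (Set.Ici t) t :=
    (hasDerivWithinAt_const t (Set.Ici t) (0 : ℝ)).congr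
      (fun x hx => hz x (ht.trans hx)) (hz t ht)
  exact (uniqueDiffOn_Ici t t Set.self_mem_Ici).eq_deriv _ (hd t).hasDerivAt.hasDerivWithinAt h1

theorem IsEnergyMinimizing.integral_radial_nonpos (hu : IsEnergyMinimizing Ω N u)
    (hR : closedBall y R ⊆ Ω) {D : Fin n → Fin p → EuclideanSpace ℝ (Fin n) → ℝ}
    (hD : ∀ i j, IsWeakPartial (ball y R) (fun x => u x j) i (D i j))
    {h : ℝ → ℝ} (hh : ContDiff ℝ ∞ h) (hanti : Antitone h) {ρ : ℝ} (hρ0 : 0 < ρ) (hρ : ρ < R)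
    (hz : ∀ t, ρ ^ 2 ≤ t → h t = 0) :
    ∫ z in ball y R, (((n : ℝ) - 2) * h (‖z - y‖ ^ 2) +
      2 * deriv h (‖z - y‖ ^ 2) * ‖z - y‖ ^ 2) * ∑ i, ∑ j, D i j z ^ 2 ≤ 0 := by
  have hd : Differentiable ℝ h := hh.differentiable (by simp)
  have hd' : ∀ t, ρ ^ 2 ≤ t → deriv h t = 0 := fun t => deriv_eq_zero_of_forall_le hd hz
  have hnsq : ContDiff ℝ ∞ fun z : EuclideanSpace ℝ (Fin n) => ‖z - y‖ ^ 2 :=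
    (contDiff_id.sub contDiff_const).norm_sq ℝ
  have hfar : ∀ z, z ∉ closedBall y ρ → ρ ^ 2 ≤ ‖z - y‖ ^ 2 := fun z hz => by
    rw [mem_closedBall, dist_eq_norm, not_le] at hz
    exact pow_le_pow_left₀ hρ0.le hz.le 2
  set η : Fin n → EuclideanSpace ℝ (Fin n) → ℝ :=
    fun k z => h (‖z - y‖ ^ 2) * (z k - y k) with hη
  have hηs : ∀ k, ContDiff ℝ ∞ (η k) := fun k => (hh.comp hnsq).mul
    ((EuclideanSpace.proj k : EuclideanSpace ℝ (Fin n) →L[ℝ] ℝ).contDiff.sub contDiff_const)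
  have hηsupp : ∀ k, tsupport (η k) ⊆ closedBall y ρ := fun k =>
    closure_minimal (fun z hzη => by
      by_contra hzb
      exact hzη (by rw [hη]; simp only [hz _ (hfar z hzb), zero_mul])) isClosed_closedBall
  have hηc : ∀ k, HasCompactSupport (η k) := fun k =>
    (isCompact_closedBall y ρ).of_isClosed_subset (isClosed_tsupport _) (hηsupp k)
  set P : EuclideanSpace ℝ (Fin n) → ℝ := fun z => ∑ i, ∑ j, D i j z ^ 2 with hP
  have hP0 : ∀ z, 0 ≤ P z := fun z =>
    Finset.sum_nonneg fun i _ => Finset.sum_nonneg fun j _ => sq_nonneg _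
  have hPint : Integrable P (volume.restrict (ball y R)) :=
    integrable_finsetSum _ fun i _ => integrable_finsetSum _ fun j _ => (hD i j).1.integrable_sq
  set T : Fin n → EuclideanSpace ℝ (Fin n) → ℝ := fun k z => ∑ i, ∑ j,
      (2 * fderiv ℝ (η k) z (EuclideanSpace.single i (1 : ℝ)) * (D i j z * D k j z) -
        fderiv ℝ (η k) z (EuclideanSpace.single k (1 : ℝ)) * D i j z ^ 2) with hT
  have hT0 : ∀ k, ∫ z in ball y R, T k z = 0 := fun k =>
    hu.first_variation (hρ0.trans hρ) hR hD (hηs k) (hηc k)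
      ((hηsupp k).trans (closedBall_subset_ball hρ)) k
  have hTint : ∀ k, Integrable (T k) (volume.restrict (ball y R)) := fun k => by
    have c : ∀ l, Continuous fun z => fderiv ℝ (η k) z (EuclideanSpace.single l (1 : ℝ)) :=
      fun l => (((hηs k).fderiv_right (m := ∞) (by simp)).clm_apply contDiff_const).continuous
    have c' : ∀ l, HasCompactSupport fun z =>
        fderiv ℝ (η k) z (EuclideanSpace.single l (1 : ℝ)) := fun l =>
      (hηc k).mono' ((subset_tsupport _).trans (tsupport_fderiv_apply_subset ℝ _))
    refine integrable_finsetSum _ fun i _ => integrable_finsetSum _ fun j _ =>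
      (integrable_continuous_mul (continuous_const.mul (c i)) (c' i).mul_left
        ((hD i j).1.integrable_mul (hD k j).1)).sub
      (integrable_continuous_mul (c k) (c' k) (hD i j).1.integrable_sq)
  have hpt : ∀ z, (((n : ℝ) - 2) * h (‖z - y‖ ^ 2) +
      2 * deriv h (‖z - y‖ ^ 2) * ‖z - y‖ ^ 2) * P z ≤ -∑ k, T k z := fun z => by
    have e := sum_radial_variation (fun i j => D i j z) (fun i => z i - y i) (h (‖z - y‖ ^ 2))
      (deriv h (‖z - y‖ ^ 2))
    have e' : ∑ k, T k z = _ := Eq.trans (by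
      simp only [hT, hη, fderiv_radial_mul_coord hd]) e
    have e'' : ∑ i, (z i - y i) ^ 2 = ‖z - y‖ ^ 2 := by
      rw [EuclideanSpace.real_norm_sq_eq]; rfl
    rw [e', e'']
    -- This is the discarded radial derivative term; its sign comes from `h` being decreasing.
    have h1 : deriv h (‖z - y‖ ^ 2) * ∑ j, (∑ i, (z i - y i) * D i j z) ^ 2 ≤ 0 :=
      mul_nonpos_of_nonpos_of_nonneg hanti.deriv_nonpos (Finset.sum_nonneg fun j _ => sq_nonneg _)
    rw [hP]
    linarith
  have hLint : Integrable (fun z => (((n : ℝ) - 2) * h (‖z - y‖ ^ 2) +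
      2 * deriv h (‖z - y‖ ^ 2) * ‖z - y‖ ^ 2) * P z) (volume.restrict (ball y R)) := by
    refine integrable_continuous_mul ?_ ?_ hPint
    · exact (continuous_const.mul (hh.continuous.comp hnsq.continuous)).add
        ((continuous_const.mul ((hh.continuous_deriv (by simp)).comp hnsq.continuous)).mul
          hnsq.continuous)
    · refine HasCompactSupport.intro (isCompact_closedBall y ρ) fun z hzb => ?_
      rw [hz _ (hfar z hzb), hd' _ (hfar z hzb)]
      simp
  have hTsum : Integrable (fun z => ∑ k, T k z) (volume.restrict (ball y R)) :=
    integrable_finsetSum _ fun k _ => hTint k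
  refine (integral_mono hLint hTsum.neg hpt).trans_eq ?_
  simp only [Pi.neg_apply]
  rw [integral_neg, integral_finsetSum _ fun k _ => hTint k]
  simp [hT0]

end Radial

/-! ### The monotonicity formula -/

section Monotonicity

variable {n p : ℕ} {Ω : Set (EuclideanSpace ℝ (Fin n))} {N : Set (EuclideanSpace ℝ (Fin p))}
  {u : EuclideanSpace ℝ (Fin n) → EuclideanSpace ℝ (Fin p)} {y : EuclideanSpace ℝ (Fin n)} {R : ℝ}

theorem IsEnergyMinimizing.monotoneOn_smoothed_energy (hu : IsEnergyMinimizing Ω N u)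
    (hR : closedBall y R ⊆ Ω) {D : Fin n → Fin p → EuclideanSpace ℝ (Fin n) → ℝ}
    (hD : ∀ i j, IsWeakPartial (ball y R) (fun x => u x j) i (D i j))
    {H : ℝ → ℝ} (hH : ContDiff ℝ ∞ H) (hanti : Antitone H) (hz : ∀ t, 1 ≤ t → H t = 0) :
    MonotoneOn (fun ρ : ℝ => ρ ^ (2 - (n : ℤ)) *
      ∫ z in ball y R, H (‖z - y‖ ^ 2 / ρ ^ 2) * ∑ i, ∑ j, D i j z ^ 2) (Set.Ioo 0 R) := by
  set P : EuclideanSpace ℝ (Fin n) → ℝ := fun z => ∑ i, ∑ j, D i j z ^ 2 with hP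
  have hP0 : ∀ z, 0 ≤ P z := fun z =>
    Finset.sum_nonneg fun i _ => Finset.sum_nonneg fun j _ => sq_nonneg _
  have hPint : Integrable P (volume.restrict (ball y R)) :=
    integrable_finsetSum _ fun i _ => integrable_finsetSum _ fun j _ => (hD i j).1.integrable_sq
  have hd : Differentiable ℝ H := hH.differentiable (by simp)
  have hd' : ∀ t, 1 ≤ t → deriv H t = 0 := fun t => deriv_eq_zero_of_forall_le hd hz
  have hd'c : Continuous (deriv H) := hH.continuous_deriv (by simp)
  obtain ⟨C, hC⟩ : ∃ C, ∀ t, 0 ≤ t → |deriv H t| ≤ C := by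
    obtain ⟨C, hC⟩ := isCompact_Icc.exists_bound_of_continuousOn (s := Set.Icc (0 : ℝ) 1)
      hd'c.continuousOn
    refine ⟨C, fun t ht => ?_⟩
    rcases le_total t 1 with h1 | h1
    · exact hC t ⟨ht, h1⟩
    · rw [hd' t h1, abs_zero]
      exact (norm_nonneg _).trans (hC 0 ⟨le_rfl, zero_le_one⟩)
  have hC0 : 0 ≤ C := (abs_nonneg _).trans (hC 0 le_rfl)
  have hHb : ∀ t, 0 ≤ t → |H t| ≤ H 0 := fun t ht => by
    have h1 : 0 ≤ H t := by
      rcases le_total t 1 with h1 | h1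
      · rw [← hz 1 le_rfl]; exact hanti h1
      · rw [hz t h1]
    rw [abs_of_nonneg h1]; exact hanti ht
  have hnc : Continuous fun z : EuclideanSpace ℝ (Fin n) => ‖z - y‖ ^ 2 := by fun_prop
  have hderiv : ∀ ρ ∈ Set.Ioo (0 : ℝ) R, HasDerivAt
      (fun ρ : ℝ => ∫ z in ball y R, H (‖z - y‖ ^ 2 / ρ ^ 2) * P z)
      (∫ z in ball y R, deriv H (‖z - y‖ ^ 2 / ρ ^ 2) * (-2 * ‖z - y‖ ^ 2 / ρ ^ 3) * P z) ρ := by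
    intro ρ hρ
    refine (hasDerivAt_integral_of_dominated_loc_of_deriv_le (s := Set.Ioi (ρ / 2))
      -- Radii stay above `ρ / 2` and `‖z - y‖ < R` on the ball, which bounds the ρ-derivative of
      -- the cutoff uniformly.
      (bound := fun z => C * (2 * R ^ 2 / (ρ / 2) ^ 3) * P z)
      (F' := fun ρ z => deriv H (‖z - y‖ ^ 2 / ρ ^ 2) * (-2 * ‖z - y‖ ^ 2 / ρ ^ 3) * P z)
      (Ioi_mem_nhds (by linarith [hρ.1])) (Eventually.of_forall fun r => ?_) ?_ ?_ ?_
      (hPint.const_mul _) ?_).2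
    · exact (hH.continuous.comp (hnc.div_const _)).aestronglyMeasurable.mul
        hPint.aestronglyMeasurable
    · exact hPint.bdd_mul (c := H 0)
        (hH.continuous.comp (hnc.div_const _)).aestronglyMeasurable
        (ae_of_all _ fun z => hHb _ (by positivity))
    · exact ((hd'c.comp (hnc.div_const _)).mul
        ((continuous_const.mul hnc).div_const _)).aestronglyMeasurable.mul
        hPint.aestronglyMeasurable
    · filter_upwards [ae_restrict_mem measurableSet_ball] with z hzB r hr
      have hr0 : 0 < r := lt_trans (by linarith [hρ.1]) hr
      have hρ2 : 0 < ρ / 2 := by linarith [hρ.1]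
      rw [mem_ball, dist_eq_norm] at hzB
      rw [norm_mul, norm_mul, Real.norm_eq_abs, Real.norm_eq_abs, Real.norm_eq_abs,
        abs_of_nonneg (hP0 z)]
      refine mul_le_mul_of_nonneg_right (mul_le_mul (hC _ (by positivity)) ?_ (abs_nonneg _) hC0)
        (hP0 z)
      rw [abs_div, abs_mul, abs_of_pos (pow_pos hr0 3), abs_of_nonneg (sq_nonneg ‖z - y‖)]
      have : |(-2 : ℝ)| = 2 := by norm_num
      rw [this]
      have hr' : ρ / 2 ≤ r := le_of_lt hr
      gcongr
    · refine ae_of_all _ fun z r hr => ?_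
      have hr0 : r ≠ 0 := (lt_trans (by linarith [hρ.1]) (Set.mem_Ioi.1 hr)).ne'
      have h1 : HasDerivAt (fun r : ℝ => ‖z - y‖ ^ 2 / r ^ 2) (-2 * ‖z - y‖ ^ 2 / r ^ 3) r := by
        have := (hasDerivAt_const r (‖z - y‖ ^ 2)).div (hasDerivAt_pow 2 r) (pow_ne_zero 2 hr0)
        refine this.congr_deriv ?_
        field_simp
        push_cast
        ring
      exact ((hd _).hasDerivAt.comp r h1).mul_const (P z)
  have hderiv' : ∀ ρ ∈ Set.Ioo (0 : ℝ) R, ∃ c, 0 ≤ c ∧ HasDerivAt (fun ρ : ℝ => ρ ^ (2 - (n : ℤ)) *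
      ∫ z in ball y R, H (‖z - y‖ ^ 2 / ρ ^ 2) * P z) c ρ := by
    intro ρ hρ
    refine ⟨_, ?_, (hasDerivAt_zpow (2 - (n : ℤ)) ρ (Or.inl hρ.1.ne')).mul (hderiv ρ hρ)⟩
    have hρ0 := hρ.1.ne'
    have hsc : ∀ t, deriv (fun t => H (t / ρ ^ 2)) t = deriv H (t / ρ ^ 2) / ρ ^ 2 := fun t => by
      have := (hd (t / ρ ^ 2)).hasDerivAt.comp t ((hasDerivAt_id t).div_const (ρ ^ 2))
      rw [show (fun t => H (t / ρ ^ 2)) = H ∘ fun t => id t / ρ ^ 2 from rfl, this.deriv]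
      ring
    have key := hu.integral_radial_nonpos hR hD (h := fun t => H (t / ρ ^ 2))
      (hH.comp (contDiff_id.div_const _))
      (fun a b hab => hanti (div_le_div_of_nonneg_right hab (by positivity))) hρ.1 hρ.2
      (fun t ht => hz _ (by rwa [one_le_div (pow_pos hρ.1 2)]))
    simp only [hsc] at key
    have i1 : Integrable (fun z => H (‖z - y‖ ^ 2 / ρ ^ 2) * P z) (volume.restrict (ball y R)) :=
      hPint.bdd_mul (c := H 0) (hH.continuous.comp (hnc.div_const _)).aestronglyMeasurable
        (ae_of_all _ fun z => hHb _ (by positivity))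
    have i2 : Integrable (fun z => deriv H (‖z - y‖ ^ 2 / ρ ^ 2) * (-2 * ‖z - y‖ ^ 2 / ρ ^ 3) * P z)
        (volume.restrict (ball y R)) := by
      refine hPint.bdd_mul (c := C * (2 * R ^ 2 / ρ ^ 3)) ((hd'c.comp (hnc.div_const _)).mul
        ((continuous_const.mul hnc).div_const _)).aestronglyMeasurable ?_
      filter_upwards [ae_restrict_mem measurableSet_ball] with z hzB
      rw [mem_ball, dist_eq_norm] at hzB
      have hρp := hρ.1
      rw [norm_mul, Real.norm_eq_abs, Real.norm_eq_abs, abs_div, abs_mul,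
        abs_of_pos (pow_pos hρ.1 3), abs_of_nonneg (sq_nonneg ‖z - y‖)]
      refine mul_le_mul (hC _ (by positivity)) ?_ (by positivity) hC0
      have : |(-2 : ℝ)| = 2 := by norm_num
      rw [this]
      gcongr
    -- The left side is the radial inequality for `H (t / ρ ^ 2)`; the right side is -ρ^{n-1} times
    -- the derivative of the weighted integral scaled by ρ^{2-n}.
    have e : ∫ z in ball y R, (((n : ℝ) - 2) * H (‖z - y‖ ^ 2 / ρ ^ 2) +
        2 * (deriv H (‖z - y‖ ^ 2 / ρ ^ 2) / ρ ^ 2) * ‖z - y‖ ^ 2) * ∑ i, ∑ j, D i j z ^ 2 =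
        ((n : ℝ) - 2) * (∫ z in ball y R, H (‖z - y‖ ^ 2 / ρ ^ 2) * P z) - ρ *
        ∫ z in ball y R, deriv H (‖z - y‖ ^ 2 / ρ ^ 2) * (-2 * ‖z - y‖ ^ 2 / ρ ^ 3) * P z := by
      rw [← integral_const_mul, ← integral_const_mul,
        ← integral_sub (i1.const_mul _) (i2.const_mul _)]
      refine integral_congr_ae (ae_of_all _ fun z => ?_)
      simp only [hP]
      field_simp
      ring
    rw [e] at key
    have hzp : ρ ^ (2 - (n : ℤ)) = ρ ^ (2 - (n : ℤ) - 1) * ρ := by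
      rw [← zpow_add_one₀ hρ0]; congr 1; ring
    rw [hzp]
    push_cast
    have hpos : 0 ≤ ρ ^ (2 - (n : ℤ) - 1) := zpow_nonneg hρ.1.le _
    nlinarith [mul_nonneg hpos (neg_nonneg.2 key)]
  refine monotoneOn_of_deriv_nonneg (convex_Ioo 0 R) (fun ρ hρ => ?_) (fun ρ hρ => ?_)
    fun ρ hρ => ?_
  · obtain ⟨c, -, hc⟩ := hderiv' ρ hρ
    exact hc.continuousAt.continuousWithinAt
  · rw [interior_Ioo] at hρ
    obtain ⟨c, -, hc⟩ := hderiv' ρ hρ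
    exact hc.differentiableAt.differentiableWithinAt
  · rw [interior_Ioo] at hρ
    obtain ⟨c, hc0, hc⟩ := hderiv' ρ hρ
    rw [hc.deriv]; exact hc0

/-- `weakPartial` is chosen separately on each set, so comparing energies of different balls
requires one common integrand; almost-everywhere uniqueness of weak derivatives supplies it. -/
theorem IsEnergyMinimizing.energy_ball_eq (hu : IsEnergyMinimizing Ω N u)
    (hR : closedBall y R ⊆ Ω) {x : EuclideanSpace ℝ (Fin n)} {ρ : ℝ} (h : ball x ρ ⊆ ball y R) :
    energy (ball x ρ) u = ∫ z in ball x ρ, ∑ i, ∑ j,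
      weakPartial (ball y R) (fun x => u x j) i z ^ 2 :=
  energy_eq_of_isWeakPartial isOpen_ball fun i j => (hu.isWeakPartial hR i j).mono h

theorem energy_nonneg (U : Set (EuclideanSpace ℝ (Fin n)))
    (u : EuclideanSpace ℝ (Fin n) → EuclideanSpace ℝ (Fin p)) : 0 ≤ energy U u :=
  integral_nonneg fun _ => Finset.sum_nonneg fun _ _ => Finset.sum_nonneg fun _ _ => sq_nonneg _

theorem IsEnergyMinimizing.energy_mono (hu : IsEnergyMinimizing Ω N u)
    (hR : closedBall y R ⊆ Ω) {x : EuclideanSpace ℝ (Fin n)} {ρ : ℝ} (h : ball x ρ ⊆ ball y R) :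
    energy (ball x ρ) u ≤ energy (ball y R) u := by
  rw [hu.energy_ball_eq hR h, hu.energy_ball_eq hR subset_rfl]
  refine setIntegral_mono_set (integrable_finsetSum _ fun i _ => integrable_finsetSum _ fun j _ =>
    (hu.isWeakPartial hR i j).1.integrable_sq) (ae_of_all _ fun z =>
      Finset.sum_nonneg fun _ _ => Finset.sum_nonneg fun _ _ => sq_nonneg _)
    (Eventually.of_forall h)

/-- The monotonicity formula. -/
theorem IsEnergyMinimizing.monotoneOn_scaledEnergy (hu : IsEnergyMinimizing Ω N u)
    (hR : closedBall y R ⊆ Ω) : MonotoneOn (scaledEnergy u y) (Set.Ioo 0 R) := by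
  set D : Fin n → Fin p → EuclideanSpace ℝ (Fin n) → ℝ :=
    fun i j => weakPartial (ball y R) (fun x => u x j) i with hDdef
  have hD : ∀ i j, IsWeakPartial (ball y R) (fun x => u x j) i (D i j) := hu.isWeakPartial hR
  set P : EuclideanSpace ℝ (Fin n) → ℝ := fun z => ∑ i, ∑ j, D i j z ^ 2 with hP
  have hPint : Integrable P (volume.restrict (ball y R)) :=
    integrable_finsetSum _ fun i _ => integrable_finsetSum _ fun j _ => (hD i j).1.integrable_sq
  -- Increasingly steep smooth cutoffs, all vanishing on `t ≥ 1`, so that the limit is the indicator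
  -- of the open ball.
  set H : ℕ → ℝ → ℝ := fun m t => Real.smoothTransition (((m : ℝ) + 1) * (1 - t)) with hH
  have hHs : ∀ m, ContDiff ℝ ∞ (H m) := fun m =>
    Real.smoothTransition.contDiff.comp (contDiff_const.mul (contDiff_const.sub contDiff_id))
  have hHa : ∀ m, Antitone (H m) := fun m s t hst => Real.smoothTransition.monotone (by gcongr)
  have hHz : ∀ m t, 1 ≤ t → H m t = 0 := fun m t ht =>
    Real.smoothTransition.zero_of_nonpos
      (mul_nonpos_of_nonneg_of_nonpos (by positivity) (by linarith))
  have hlim : ∀ ρ ∈ Set.Ioo 0 R, Tendsto (fun m => ρ ^ (2 - (n : ℤ)) *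
      ∫ z in ball y R, H m (‖z - y‖ ^ 2 / ρ ^ 2) * P z) atTop (𝓝 (scaledEnergy u y ρ)) := by
    intro ρ hρ
    refine Tendsto.const_mul _ ?_
    have hsub : ball y ρ ⊆ ball y R := ball_subset_ball hρ.2.le
    rw [hu.energy_ball_eq hR hsub, ← Set.inter_eq_right.2 hsub,
      ← setIntegral_indicator measurableSet_ball]
    refine tendsto_integral_of_dominated_convergence (fun z => ‖P z‖) (fun m => ?_) hPint.norm
      (fun m => ae_of_all _ fun z => ?_) (ae_of_all _ fun z => ?_)
    · exact ((hHs m).continuous.comp (by fun_prop :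
        Continuous fun z : EuclideanSpace ℝ (Fin n) =>
          ‖z - y‖ ^ 2 / ρ ^ 2)).aestronglyMeasurable.mul hPint.aestronglyMeasurable
    · rw [norm_mul]
      refine mul_le_of_le_one_left (norm_nonneg _) ?_
      rw [Real.norm_eq_abs, abs_of_nonneg (Real.smoothTransition.nonneg _)]
      exact Real.smoothTransition.le_one _
    · by_cases hz : z ∈ ball y ρ
      · rw [Set.indicator_of_mem hz]
        refine tendsto_const_nhds.congr' ?_
        rw [mem_ball, dist_eq_norm] at hz
        have hlt : 0 < 1 - ‖z - y‖ ^ 2 / ρ ^ 2 := by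
          rw [sub_pos, div_lt_one (pow_pos hρ.1 2)]
          exact pow_lt_pow_left₀ hz (norm_nonneg _) two_ne_zero
        obtain ⟨m₀, hm₀⟩ := exists_nat_gt (1 / (1 - ‖z - y‖ ^ 2 / ρ ^ 2))
        filter_upwards [eventually_ge_atTop m₀] with m hm
        have h1 : H m (‖z - y‖ ^ 2 / ρ ^ 2) = 1 := by
          refine Real.smoothTransition.one_of_one_le ?_
          rw [div_lt_iff₀ hlt] at hm₀
          have : (m₀ : ℝ) ≤ m := by exact_mod_cast hm
          nlinarith
        rw [h1, one_mul]
      · rw [Set.indicator_of_notMem hz]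
        refine tendsto_const_nhds.congr fun m => ?_
        rw [mem_ball, dist_eq_norm, not_lt] at hz
        rw [hHz m _ (by
          rw [one_le_div (pow_pos hρ.1 2)]; exact pow_le_pow_left₀ hρ.1.le hz 2), zero_mul]
  intro a ha b hb hab
  exact le_of_tendsto_of_tendsto' (hlim a ha) (hlim b hb) fun m =>
    hu.monotoneOn_smoothed_energy hR hD (hHs m) (hHa m) (hHz m) ha hb hab

end Monotonicity

/-! ### The density -/

section Density

variable {n p : ℕ} {Ω : Set (EuclideanSpace ℝ (Fin n))} {N : Set (EuclideanSpace ℝ (Fin p))}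
  {u : EuclideanSpace ℝ (Fin n) → EuclideanSpace ℝ (Fin p)} {y : EuclideanSpace ℝ (Fin n)} {R : ℝ}

theorem scaledEnergy_nonneg {ρ : ℝ} (hρ : 0 < ρ) : 0 ≤ scaledEnergy u y ρ :=
  mul_nonneg (zpow_nonneg hρ.le _) (energy_nonneg _ _)

theorem IsEnergyMinimizing.tendsto_density (hu : IsEnergyMinimizing Ω N u) (h0 : 0 < R)
    (hR : closedBall y R ⊆ Ω) :
    Tendsto (scaledEnergy u y) (𝓝[>] (0 : ℝ)) (𝓝 (density u y)) := by
  have h : ∃ l, Tendsto (scaledEnergy u y) (𝓝[>] (0 : ℝ)) (𝓝 l) := by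
    -- A nondecreasing function bounded below by 0 converges to its infimum at the left end of the
    -- interval.
    refine ⟨sInf (scaledEnergy u y '' Set.Ioo 0 R), ?_⟩
    have := (hu.monotoneOn_scaledEnergy hR).tendsto_nhdsWithin_Ioo_right (by simpa using h0)
      ⟨0, by
        rintro _ ⟨ρ, hρ, rfl⟩
        exact scaledEnergy_nonneg hρ.1⟩
    exact this
  exact tendsto_nhds_limUnder h

theorem IsEnergyMinimizing.density_le_scaledEnergy (hu : IsEnergyMinimizing Ω N u)
    (hR : closedBall y R ⊆ Ω) {ρ : ℝ} (hρ : ρ ∈ Set.Ioo 0 R) :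
    density u y ≤ scaledEnergy u y ρ := by
  refine le_of_tendsto (hu.tendsto_density (hρ.1.trans hρ.2) hR) ?_
  filter_upwards [Ioo_mem_nhdsGT hρ.1] with r hr
  exact hu.monotoneOn_scaledEnergy hR ⟨hr.1, hr.2.trans hρ.2⟩ hρ hr.2.le

theorem IsEnergyMinimizing.upperSemicontinuousOn_density (hΩ : IsOpen Ω)
    (hu : IsEnergyMinimizing Ω N u) : UpperSemicontinuousOn (density u) Ω := by
  intro y hy c hc
  obtain ⟨R, hR0, hR⟩ := nhds_basis_closedBall.mem_iff.1 (hΩ.mem_nhds hy)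
  obtain ⟨ρ, hρc, hρ⟩ := (((hu.tendsto_density hR0 hR).eventually (Iio_mem_nhds hc)).and
    (Ioo_mem_nhdsGT hR0)).exists
  have hcont : ContinuousAt (fun r : ℝ => r ^ (2 - (n : ℤ)) * energy (ball y ρ) u) ρ :=
    (continuousAt_zpow₀ ρ _ (Or.inl hρ.1.ne')).mul continuousAt_const
  have hev : ∀ᶠ r in 𝓝[<] ρ, r ^ (2 - (n : ℤ)) * energy (ball y ρ) u < c :=
    (hcont.eventually (Iio_mem_nhds hρc)).filter_mono nhdsWithin_le_nhds
  -- Shrinking only the radius in the scaling factor, with the energy still taken on `ball y ρ`,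
  -- leaves room to move the centre.
  obtain ⟨r, hrc, hr⟩ := (hev.and (Ioo_mem_nhdsLT hρ.1)).exists
  have hyR : closedBall y ρ ⊆ Ω := (closedBall_subset_closedBall hρ.2.le).trans hR
  filter_upwards [mem_nhdsWithin_of_mem_nhds
    (ball_mem_nhds y (half_pos (sub_pos.2 hr.2)))] with x hx
  rw [mem_ball] at hx
  -- Monotonicity at `x` holds on an open interval of radii, so a radius strictly larger than `r`
  -- must fit; the midpoint does, since `x` is within `(ρ - r) / 2` of `y`.
  have hxR : closedBall x ((r + ρ) / 2) ⊆ Ω :=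
    (closedBall_subset_closedBall' (by linarith)).trans hyR
  refine (hu.density_le_scaledEnergy hxR (ρ := r) ⟨hr.1, by linarith [hr.2]⟩).trans_lt
    (lt_of_le_of_lt ?_ hrc)
  exact mul_le_mul_of_nonneg_left
    (hu.energy_mono hyR (ball_subset_ball' (by linarith [hr.2]))) (zpow_nonneg hr.1.le _)

end Density
end

theorem theorem3 {n m p : ℕ} (hn : 2 ≤ n)
    {Ω : Set (EuclideanSpace ℝ (Fin n))} (hΩ : IsOpen Ω)
    {M : Type*} [TopologicalSpace M] [CompactSpace M]
    [ChartedSpace (EuclideanSpace ℝ (Fin m)) M] [IsManifold (𝓡 m) ∞ M]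
    (g : Bundle.ContMDiffRiemannianMetric (𝓡 m) ∞ (EuclideanSpace ℝ (Fin m))
      (fun x : M => TangentSpace (𝓡 m) x))
    (ι : M → EuclideanSpace ℝ (Fin p)) (hι : IsIsometricEmbedding g ι)
    (u : EuclideanSpace ℝ (Fin n) → EuclideanSpace ℝ (Fin p))
    (hu : IsEnergyMinimizing Ω (Set.range ι) u) :
    (∀ y ∈ Ω, Tendsto (scaledEnergy u y) (𝓝[>] (0 : ℝ)) (𝓝 (density u y))) ∧
    UpperSemicontinuousOn (density u) Ω ∧
    ∀ (y : EuclideanSpace ℝ (Fin n)) (yseq : ℕ → EuclideanSpace ℝ (Fin n)),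
      y ∈ Ω → (∀ k, yseq k ∈ Ω) → Tendsto yseq atTop (𝓝 y) →
        limsup (fun k => ((density u (yseq k) : ℝ) : EReal)) atTop ≤ ((density u y : ℝ) : EReal) := by
  have husc := hu.upperSemicontinuousOn_density hΩ
  refine ⟨fun y hy => ?_, husc, fun y yseq hy hyseq hlim => ?_⟩
  · obtain ⟨R, hR0, hR⟩ := nhds_basis_closedBall.mem_iff.1 (hΩ.mem_nhds hy)
    exact hu.tendsto_density hR0 hR
  · have hlim' : Tendsto yseq atTop (𝓝[Ω] y) :=
      tendsto_nhdsWithin_iff.2 ⟨hlim, Eventually.of_forall hyseq⟩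
    -- It suffices to bound the limsup by every real `c` above the density at `y`; semicontinuity
    -- makes the densities along the sequence eventually less than `c`.
    refine EReal.le_of_forall_lt_iff_le.1 fun c hc => ?_
    exact limsup_le_of_le (h := (hlim'.eventually (husc y hy c (EReal.coe_lt_coe_iff.1 hc))).mono
      fun k hk => EReal.coe_le_coe_iff.2 hk.le)
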